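/- Let $d\in\{2,3\}$ and let $\Omega\subset\mathbb{R}^d$ be a bounded open set with a conforming mesh $\mathcal{E}_h$ of finitely many cuboids (rectangular boxes, possibly rotated) $E=\mu_E([0,1]^d)$, $\mu_E(\hat x)=B_E\hat x+b_E$. Let $\Gamma_h^{\mathrm{int}}$ be the set of interior faces $e$, each with a unit normal $n_e$ pointing from $E_e^1$ to $E_e^2$, jump $[\phi]=\phi|_{E_e^1}-\phi|_{E_e^2}$ and average $\{\phi\}=\frac12(\phi|_{E_e^1}+\phi|_{E_e^2})$. Let the boundary faces be partitioned into Dirichlet faces $\Gamma_h^D$ and the others $\Gamma_h^N$, with $n_e=n$ the outer unit normal. Put $h_e=\min(|E_e^1|,|E_e^2|)/|e|$ on interior faces, $h_e=|E|/|e|$ on boundary faces of a cell $E$, and let $\sigma\in\mathbb{R}$ be the penalty parameter. Let $(\cdot,\cdot)_{0,\omega}$ denote the $L^2$ product on $\omega$. Let $p\ge 1$; let $Q_h^p$ be the functions $v$ on $\Omega$ for which every $v|_E\circ\mu_E$ is a polynomial of degree at most $p$ in each variable, without continuity across faces; $X_h^p=(Q_h^p)^d$; and $M_h^{p-1}=Q_h^{p-1}$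 if $\Gamma_h^N\neq\emptyset$, $M_h^{p-1}=\{q\in Q_h^{p-1}:\int_\Omega q=0\}$ if $\Gamma_h^N=\emptyset$. The Dirichlet datum $g$ is integrable on the Dirichlet faces, and $\int_{\partial\Omega}g\cdot n=0$ if $\Gamma_h^N=\emptyset$. Define, with cellwise derivatives and with traces from inside the cell on boundary faces, $$b(v,q)=-\sum_{E}(\nabla\cdot v,q)_{0,E}+\sum_{e\in\Gamma_h^{\mathrm{int}}}([v]\cdot n_e,\{q\})_{0,e}+\sum_{e\in\Gamma_h^D}(v\cdot n,q)_{0,e},\qquad r(q)=\sum_{e\in\Gamma_h^D}(g\cdot n,q)_{0,e},$$ $$\alpha(\psi,q)=b(\nabla\psi,q)-\sum_{e\in\Gamma_h^{\mathrm{int}}}(\{\nabla q\}\cdot n_e,[\psi])_{0,e}+\sum_{e\in\Gamma_h^{\mathrm{int}}}\frac{\sigma}{h_e}([q],[\psi])_{0,e}-\sum_{e\in\Gamma_h^N}(\nabla q\cdot n,\psi)_{0,e}+\sum_{e\in\Gamma_h^N}\frac{\sigma}{h_e}(q,\psi)_{0,e}.$$ Let $k=p-1$. With the Piola transform $T_E\hat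 v(\mu_E(\hat x))=|\det B_E|^{-1}B_E\hat v(\hat x)$, let $\mathrm{RT}_E^k$ (respectively $\Psi_E^k$) be the fields $T_E\hat v$ with $\hat v$ polynomial, $\hat v_i$ being of degree at most $k+\delta_{ij}$ (respectively $k-\delta_{ij}$) in $\hat x_j$, and let $\mathrm{RT}_h^k=\{v\in H(\mathrm{div};\Omega): v|_E\in\mathrm{RT}_E^k\ \forall E\}$. Let $Q_e^k$ be the polynomials on the face $e$ of degree at most $k$ in each face variable. For $w_h\in X_h^p$, the Raviart–Thomas projection $v_h=\mathcal{P}_h^{\mathrm{RT}}w_h$ is computed as follows. (i) Solve for $\psi_h\in M_h^{p-1}$: $\alpha(\psi_h,q)=b(w_h,q)-r(q)$ for all $q\in M_h^{p-1}$. (ii) Reconstruct $\gamma_h=G_h\psi_h\in\mathrm{RT}_h^{k}$ by $(\gamma_h\cdot n_e,q)_{0,e}=(-\{\nabla\psi_h\}\cdot n_e+\frac{\sigma}{h_e}[\psi_h],q)_{0,e}$ for $e\in\Gamma_h^{\mathrm{int}}$, $(\gamma_h\cdot n_e,q)_{0,e}=(-\nabla\psi_h\cdot n_e+\frac{\sigma}{h_e}\psi_h,q)_{0,e}$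 for $e\in\Gamma_h^N$, and $(\gamma_h\cdot n_e,q)_{0,e}=0$ for $e\in\Gamma_h^D$, each for all $q\in Q_e^k$, and, if $k>0$, for all cells $E$ and all $\rho\in\Psi_E^k$, $$(\gamma_h,\rho)_{0,E}=-(\nabla\psi_h,\rho)_{0,E}+\frac12\sum_{e\subset\partial E,\,e\in\Gamma_h^{\mathrm{int}}}(\rho\cdot n_e,[\psi_h])_{0,e}+\sum_{e\subset\partial E,\,e\in\Gamma_h^N}(\rho\cdot n_e,\psi_h)_{0,e}.$$ (iii) Let $v_h\in X_h^p$ solve $(v_h,\varphi)_{0,\Omega}=(w_h,\varphi)_{0,\Omega}+(\gamma_h,\varphi)_{0,\Omega}$ for all $\varphi\in X_h^p$ (that is, $v_h=w_h+\gamma_h$). Then every $v_h$ obtained in this way satisfies the discrete continuity equation exactly: $$b(\mathcal{P}_h^{\mathrm{RT}}w_h,q)=r(q)\qquad\text{for all } q\in M_h^{p-1}.$$ -/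

import Mathlib

open MeasureTheory Matrix

noncomputable section

namespace RTProj

/-- Points and vectors of `ℝ^d` with `d = n + 1`. The Euclidean scalar product is written `⬝ᵥ`;
the sup norm which Mathlib puts on this type is never used for lengths. -/
abbrev Pt (n : ℕ) : Type := Fin (n + 1) → ℝ

/-- Gradient of a scalar function. -/
def grad {n : ℕ} (f : Pt n → ℝ) (x : Pt n) : Pt n :=
  fun i => fderiv ℝ f x (Pi.single i 1)

/-- Divergence of a vector field. -/
def divergence {n : ℕ} (v : Pt n → Pt n) (x : Pt n) : ℝ :=
  ∑ i, fderiv ℝ v x (Pi.single i 1) i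

/-- `H(div; Ω)`: square integrable fields whose distributional divergence on the open set `Ω`
is a square integrable function. -/
def MemHdiv {n : ℕ} (Ω : Set (Pt n)) (v : Pt n → Pt n) : Prop :=
  MemLp v 2 (volume.restrict Ω) ∧
    ∃ w : Pt n → ℝ, MemLp w 2 (volume.restrict Ω) ∧
      ∀ φ : Pt n → ℝ, ContDiff ℝ (⊤ : ℕ∞) φ → HasCompactSupport φ → tsupport φ ⊆ Ω →
        ∫ x in Ω, v x ⬝ᵥ grad φ x = -∫ x in Ω, w x * φ x

/-! ### Cuboids -/

/-- A nondegenerate cuboid (rectangular box, possibly rotated) in `ℝ^(n+1)`, given by its affine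
map `x̂ ↦ B x̂ + b` from the reference cube `[0,1]^(n+1)`. The columns of `B`, which are the edges
of the cuboid, are pairwise orthogonal. -/
structure Cuboid (n : ℕ) where
  B : Matrix (Fin (n + 1)) (Fin (n + 1)) ℝ
  b : Pt n
  det_ne_zero : B.det ≠ 0
  orthogonal : ∀ i j, i ≠ j → B.col i ⬝ᵥ B.col j = 0

namespace Cuboid

variable {n : ℕ} (K : Cuboid n)

/-- The affine map `μ_E` of the cuboid. -/
def map (x : Pt n) : Pt n := K.B *ᵥ x + K.b

/-- The closed cuboid as a set of points. -/
def carrier : Set (Pt n) := K.map '' Set.Icc 0 1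

/-- Euclidean length of the `i`-th edge. -/
def len (i : Fin (n + 1)) : ℝ := Real.sqrt (K.B.col i ⬝ᵥ K.B.col i)

/-- `S` is a face, of any dimension, of the cuboid: some of the reference coordinates are fixed to
`0` or `1`. -/
def IsFace (S : Set (Pt n)) : Prop :=
  ∃ (J : Finset (Fin (n + 1))) (s : Fin (n + 1) → Bool),
    S = K.map '' {x ∈ Set.Icc (0 : Pt n) 1 | ∀ j ∈ J, x j = if s j then 1 else 0}

/-- Parametrization by `[0,1]^n` of the facet on which the `i`-th reference coordinate is `0`
(`s = false`) or `1` (`s = true`). -/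
def facetMap (i : Fin (n + 1)) (s : Bool) (y : Fin n → ℝ) : Pt n :=
  K.map (i.insertNth (if s then 1 else 0 : ℝ) y)

/-- The `n`-dimensional area of the facets with index `i`. -/
def facetArea (i : Fin (n + 1)) : ℝ := ∏ j : Fin n, K.len (i.succAbove j)

/-- Outer unit normal of a facet. -/
def facetNormal (i : Fin (n + 1)) (s : Bool) : Pt n :=
  ((if s then 1 else -1 : ℝ) / K.len i) • K.B.col i

/-- Surface integral over a facet. -/
def facetIntegral (i : Fin (n + 1)) (s : Bool) (F : Pt n → ℝ) : ℝ :=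
  K.facetArea i * ∫ y in Set.Icc (0 : Fin n → ℝ) 1, F (K.facetMap i s y)

/-- `f` is the image of a polynomial of degree at most `k` in each reference variable. -/
def IsQ (k : ℕ) (f : Pt n → ℝ) : Prop :=
  ∃ q : MvPolynomial (Fin (n + 1)) ℝ,
    (∀ α ∈ q.support, ∀ j, α j ≤ k) ∧ ∀ x : Pt n, f (K.map x) = MvPolynomial.eval x q

/-- On the given facet `f` is a polynomial of degree at most `k` in each variable. -/
def IsFacetQ (k : ℕ) (i : Fin (n + 1)) (s : Bool) (f : Pt n → ℝ) : Prop :=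
  ∃ q : MvPolynomial (Fin n) ℝ,
    (∀ α ∈ q.support, ∀ j, α j ≤ k) ∧
      ∀ y : Fin n → ℝ, f (K.facetMap i s y) = MvPolynomial.eval y q

/-- The Piola transform of the polynomial field `v`, evaluated at the image of the reference
point `x`. -/
def piola (v : Fin (n + 1) → MvPolynomial (Fin (n + 1)) ℝ) (x : Pt n) : Pt n :=
  (1 / |K.B.det|) • (K.B *ᵥ fun i => MvPolynomial.eval x (v i))

/-- The local Raviart-Thomas space of degree `k`: in component `i` the degree in variable `j` is
at most `k + δ_ij`. -/
def IsRT (k : ℕ) (v : Pt n → Pt n) : Prop :=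
  ∃ u : Fin (n + 1) → MvPolynomial (Fin (n + 1)) ℝ,
    (∀ i, ∀ α ∈ (u i).support, ∀ j, α j ≤ k + if i = j then 1 else 0) ∧
      ∀ x : Pt n, v (K.map x) = K.piola u x

/-- The local space `Ψ_E^k` of interior test fields: in component `i` the degree in variable `j`
is at most `k - δ_ij`, an integer; for `k = 0` only the zero field remains. -/
def IsPsi (k : ℕ) (v : Pt n → Pt n) : Prop :=
  ∃ u : Fin (n + 1) → MvPolynomial (Fin (n + 1)) ℝ,
    (∀ i, ∀ α ∈ (u i).support, ∀ j, (α j + if i = j then 1 else 0) ≤ k) ∧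
      ∀ x : Pt n, v (K.map x) = K.piola u x

end Cuboid

/-! ### Meshes -/

/-- A facet of one of the `N` cells: the cell, the index of the fixed reference coordinate, and the
value `0` or `1` of that coordinate. An interior mesh face consists of two such facets. -/
abbrev Facet (n N : ℕ) : Type := Fin N × Fin (n + 1) × Bool

/-- The point set of a facet. -/
def facetSet {n N : ℕ} (cell : Fin N → Cuboid n) (f : Facet n N) : Set (Pt n) :=
  (cell f.1).facetMap f.2.1 f.2.2 '' Set.Icc 0 1

/-- A conforming mesh of `N` cuboids together with an orientation of its interior faces. -/
structure CuboidMesh (n N : ℕ) where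
  cell : Fin N → Cuboid n
  /-- Distinct cells do not overlap. -/
  disjoint : ∀ E F, E ≠ F → Disjoint (interior (cell E).carrier) (interior (cell F).carrier)
  /-- Distinct cells which touch do so in a common vertex, edge or facet. -/
  conforming : ∀ E F, E ≠ F → ((cell E).carrier ∩ (cell F).carrier).Nonempty →
    (cell E).IsFace ((cell E).carrier ∩ (cell F).carrier) ∧
      (cell F).IsFace ((cell E).carrier ∩ (cell F).carrier)
  /-- The interior faces. A pair `(f₁, f₂)` stands for the face shared by the cells
  `E¹ = f₁.1` and `E² = f₂.1`, with unit normal pointing from `E¹` to `E²`. -/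
  intFaces : Finset (Facet n N × Facet n N)
  intFaces_shared : ∀ e ∈ intFaces, e.1.1 ≠ e.2.1 ∧ facetSet cell e.1 = facetSet cell e.2
  /-- Each shared facet is an interior face, in exactly one of the two orientations. -/
  oriented : ∀ f₁ f₂ : Facet n N, f₁.1 ≠ f₂.1 → facetSet cell f₁ = facetSet cell f₂ →
    Xor ((f₁, f₂) ∈ intFaces) ((f₂, f₁) ∈ intFaces)

/-- A scalar function on the mesh which may be discontinuous across faces: one function per cell.
The function of a cell is kept on all of `ℝ^d` (in the discrete spaces it is a polynomial), so its
restriction to the facets of the cell is the trace from inside that cell. -/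
abbrev Broken (n N : ℕ) : Type := Fin N → Pt n → ℝ

/-- A vector field on the mesh which may be discontinuous across faces. -/
abbrev BrokenVec (n N : ℕ) : Type := Fin N → Pt n → Pt n

/-- Cellwise gradient. -/
def brokenGrad {n N : ℕ} (q : Broken n N) : BrokenVec n N := fun E => grad (q E)

/-- The jump `[q]` on an interior face. -/
def jump {n N : ℕ} (e : Facet n N × Facet n N) (q : Broken n N) (x : Pt n) : ℝ :=
  q e.1.1 x - q e.2.1 x

/-- The average `{q}` on an interior face. -/
def avg {n N : ℕ} (e : Facet n N × Facet n N) (q : Broken n N) (x : Pt n) : ℝ :=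
  (1 / 2) * q e.1.1 x + (1 / 2) * q e.2.1 x

/-- The jump `[v]` of a vector field on an interior face. -/
def jumpVec {n N : ℕ} (e : Facet n N × Facet n N) (v : BrokenVec n N) (x : Pt n) : Pt n :=
  v e.1.1 x - v e.2.1 x

/-- The average `{v}` of a vector field on an interior face. -/
def avgVec {n N : ℕ} (e : Facet n N × Facet n N) (v : BrokenVec n N) (x : Pt n) : Pt n :=
  (1 / 2 : ℝ) • v e.1.1 x + (1 / 2 : ℝ) • v e.2.1 x

namespace CuboidMesh

variable {n N : ℕ} (M : CuboidMesh n N)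

/-- The meshed domain. -/
def domain : Set (Pt n) := interior (⋃ E, (M.cell E).carrier)

/-- The boundary faces: the facets which belong to one cell only. By conformity they are exactly
the facets on the boundary of the domain. -/
def bdryFaces : Finset (Facet n N) := by
  classical
  exact Finset.univ.filter fun f =>
    ∀ f' : Facet n N, f'.1 ≠ f.1 → facetSet M.cell f' ≠ facetSet M.cell f

/-- Outer unit normal of a facet with respect to its cell. On an interior face `e` the vector
`M.normal e.1` is the normal `n_e`. -/
def normal (f : Facet n N) : Pt n := (M.cell f.1).facetNormal f.2.1 f.2.2

/-- Surface integral over a facet. -/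
def faceInt (f : Facet n N) (F : Pt n → ℝ) : ℝ := (M.cell f.1).facetIntegral f.2.1 f.2.2 F

/-- Area of a facet. -/
def area (f : Facet n N) : ℝ := (M.cell f.1).facetArea f.2.1

/-- Volume of a cell. -/
def vol (E : Fin N) : ℝ := volume.real (M.cell E).carrier

/-- Integral over a cell. -/
def cellInt (E : Fin N) (F : Pt n → ℝ) : ℝ := ∫ x in (M.cell E).carrier, F x

/-- The local mesh size `h_e` on an interior face. -/
def hInt (e : Facet n N × Facet n N) : ℝ := min (M.vol e.1.1) (M.vol e.2.1) / M.area e.1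

/-- The local mesh size `h_e` on a boundary face. -/
def hBdry (f : Facet n N) : ℝ := M.vol f.1 / M.area f

/-- The function on the domain (defined up to the null set of cell boundaries) that is described
by the broken field `v`. -/
def glue (v : BrokenVec n N) (x : Pt n) : Pt n :=
  ∑ E, (interior (M.cell E).carrier).indicator (v E) x

/-- The `L²(Ω)` scalar product of broken vector fields. -/
def l2Vec (u v : BrokenVec n N) : ℝ := ∑ E, M.cellInt E fun x => u E x ⬝ᵥ v E x

/-- The space `Q_h^k`. -/
def spaceQ (k : ℕ) : Set (Broken n N) := {q | ∀ E, (M.cell E).IsQ k (q E)}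

/-- The velocity space `X_h^p = (Q_h^p)^d`. -/
def spaceX (p : ℕ) : Set (BrokenVec n N) := {v | ∀ i, (fun E x => v E x i) ∈ M.spaceQ p}

/-- The mixed (Neumann type) boundary faces, if `ΓD` are the Dirichlet faces. -/
def neumann (ΓD : Finset (Facet n N)) : Finset (Facet n N) := M.bdryFaces \ ΓD

/-- The pressure space `M_h^k`: all of `Q_h^k` for mixed boundary conditions, and the functions in
`Q_h^k` with mean value zero if the whole boundary is Dirichlet. -/
def spaceM (ΓD : Finset (Facet n N)) (k : ℕ) : Set (Broken n N) :=
  {q | q ∈ M.spaceQ k ∧ (M.neumann ΓD = ∅ → ∑ E, M.cellInt E (q E) = 0)}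

/-- The bilinear form `b(v, q)` of the discrete continuity equation. -/
def b (ΓD : Finset (Facet n N)) (v : BrokenVec n N) (q : Broken n N) : ℝ :=
  -(∑ E, M.cellInt E fun x => divergence (v E) x * q E x)
    + (∑ e ∈ M.intFaces, M.faceInt e.1 fun x => (jumpVec e v x ⬝ᵥ M.normal e.1) * avg e q x)
    + ∑ f ∈ ΓD, M.faceInt f fun x => (v f.1 x ⬝ᵥ M.normal f) * q f.1 x

/-- The right-hand side `r(q)` of the discrete continuity equation with Dirichlet data `g`. -/
def r (ΓD : Finset (Facet n N)) (g : Pt n → Pt n) (q : Broken n N) : ℝ :=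
  ∑ f ∈ ΓD, M.faceInt f fun x => (g x ⬝ᵥ M.normal f) * q f.1 x

/-- The symmetrization and penalty terms `j₀(ψ, q)`. -/
def j0 (ΓD : Finset (Facet n N)) (σ : ℝ) (ψ q : Broken n N) : ℝ :=
  -(∑ e ∈ M.intFaces,
      M.faceInt e.1 fun x => (avgVec e (brokenGrad q) x ⬝ᵥ M.normal e.1) * jump e ψ x)
    + (∑ e ∈ M.intFaces, σ / M.hInt e * M.faceInt e.1 fun x => jump e q x * jump e ψ x)
    - (∑ f ∈ M.neumann ΓD, M.faceInt f fun x => (grad (q f.1) x ⬝ᵥ M.normal f) * ψ f.1 x)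
    + ∑ f ∈ M.neumann ΓD, σ / M.hBdry f * M.faceInt f fun x => q f.1 x * ψ f.1 x

/-- The stabilized SIPG form `α(ψ, q) = b(∇ψ, q) + j₀(ψ, q)`. -/
def sipg (ΓD : Finset (Facet n N)) (σ : ℝ) (ψ q : Broken n N) : ℝ :=
  M.b ΓD (brokenGrad ψ) q + M.j0 ΓD σ ψ q

/-- `ψ` solves the pressure-correction problem for the tentative velocity `w`. -/
def IsPressureCorrection (ΓD : Finset (Facet n N)) (σ : ℝ) (g : Pt n → Pt n) (p : ℕ)
    (w : BrokenVec n N) (ψ : Broken n N) : Prop :=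
  ψ ∈ M.spaceM ΓD (p - 1) ∧
    ∀ q ∈ M.spaceM ΓD (p - 1), M.sipg ΓD σ ψ q = M.b ΓD w q - M.r ΓD g q

/-- The Raviart-Thomas space `RT_h^k`. -/
def spaceRT (k : ℕ) : Set (BrokenVec n N) :=
  {v | MemHdiv M.domain (M.glue v) ∧ ∀ E, (M.cell E).IsRT k (v E)}

/-- `γ = G_h ψ` is the reconstruction of `-∇ψ` in `RT_h^k`. The face moments on an interior face
are prescribed for each of the two cells which share the face. -/
structure IsReconstruction (ΓD : Finset (Facet n N)) (σ : ℝ) (k : ℕ) (ψ : Broken n N)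
    (γ : BrokenVec n N) : Prop where
  mem_RT : γ ∈ M.spaceRT k
  moment_int : ∀ e ∈ M.intFaces, ∀ E : Fin N, E = e.1.1 ∨ E = e.2.1 →
    ∀ q : Pt n → ℝ, (M.cell e.1.1).IsFacetQ k e.1.2.1 e.1.2.2 q →
      M.faceInt e.1 (fun x => (γ E x ⬝ᵥ M.normal e.1) * q x) =
        M.faceInt e.1 fun x =>
          (-(avgVec e (brokenGrad ψ) x ⬝ᵥ M.normal e.1) + σ / M.hInt e * jump e ψ x) * q x
  moment_neumann : ∀ f ∈ M.neumann ΓD,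
    ∀ q : Pt n → ℝ, (M.cell f.1).IsFacetQ k f.2.1 f.2.2 q →
      M.faceInt f (fun x => (γ f.1 x ⬝ᵥ M.normal f) * q x) =
        M.faceInt f fun x =>
          (-(grad (ψ f.1) x ⬝ᵥ M.normal f) + σ / M.hBdry f * ψ f.1 x) * q x
  moment_dirichlet : ∀ f ∈ ΓD,
    ∀ q : Pt n → ℝ, (M.cell f.1).IsFacetQ k f.2.1 f.2.2 q →
      M.faceInt f (fun x => (γ f.1 x ⬝ᵥ M.normal f) * q x) = 0
  moment_cell : 0 < k → ∀ E : Fin N, ∀ ρ : Pt n → Pt n, (M.cell E).IsPsi k ρ →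
    M.cellInt E (fun x => γ E x ⬝ᵥ ρ x) =
      -M.cellInt E (fun x => grad (ψ E) x ⬝ᵥ ρ x)
        + (1 / 2) * (∑ e ∈ M.intFaces with e.1.1 = E ∨ e.2.1 = E,
            M.faceInt e.1 fun x => (ρ x ⬝ᵥ M.normal e.1) * jump e ψ x)
        + ∑ f ∈ M.neumann ΓD with f.1 = E,
            M.faceInt f fun x => (ρ x ⬝ᵥ M.normal f) * ψ f.1 x

/-- `v = P_h^RT w`, the result of the three steps: solve for the pressure correction `ψ`,
reconstruct `γ = G_h ψ` in `RT_h^(p-1)`, and find `v ∈ X_h^p` with `(v, φ) = (w, φ) + (γ, φ)`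
for all `φ ∈ X_h^p`. -/
def IsRTProjection (ΓD : Finset (Facet n N)) (σ : ℝ) (g : Pt n → Pt n) (p : ℕ)
    (w v : BrokenVec n N) : Prop :=
  ∃ (ψ : Broken n N) (γ : BrokenVec n N),
    M.IsPressureCorrection ΓD σ g p w ψ ∧ M.IsReconstruction ΓD σ (p - 1) ψ γ ∧
      v ∈ M.spaceX p ∧ ∀ φ ∈ M.spaceX p, M.l2Vec v φ = M.l2Vec w φ + M.l2Vec γ φ

end CuboidMesh

end RTProj

end

/-!
Cellwise integration by parts gives the dual form of the discrete divergence (`CuboidMesh.b_eq`):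
for any field `u` and test function `q` that are smooth on the cells,
`b(u, q) = ∑_E (u, ∇q)_E - ∑_int ({u} · n_e, [q])_e - ∑_N (u · n, q)_e`.
For `u = γ = G_h ψ` each term is one of the prescribed moments of the reconstruction:

* `∇q` lies in `Ψ_E^k` (`Cuboid.IsQ.isPsi_grad`; here the orthogonality of the edges enters), so
  `(γ, ∇q)_E` is a cell moment;
* `[q]` is a polynomial of degree at most `k` in each variable of the face, so `({γ} · n_e, [q])_e`
  and `(γ · n, q)_e` are face moments.

Comparison with the dual form for `u = ∇ψ` yields `b(γ, q) = -α(ψ, q)`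
(`CuboidMesh.b_reconstruction`). Since `RT_h^(p-1) ⊆ X_h^p`, the last step of the projection is the
exact update `v = w + γ` (`CuboidMesh.eq_add_of_l2Vec`), whence
`b(v, q) = b(w, q) - α(ψ, q) = r(q)` by the choice of `ψ`.

The two cells at an interior face parametrize it differently. Both parametrizations have the same
image, so they differ by an affine bijection of the unit cube, which is a signed permutation of the
coordinates (`exists_eq_cubeSymm`). Hence face integrals and polynomial degrees do not depend on the
side, and since the cells do not overlap the two outer normals are opposite
(`Cuboid.facetNormal_eq_neg`). The opposite normals also show that at most two cells meet in a
facet, so that a sum over all facets of all cells splits into interior and boundary faces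
(`CuboidMesh.sum_facets`).
-/

namespace RTProj

/-! ### Symmetries of the unit cube -/

/-- The symmetry of the unit cube `[0,1]^n` which permutes the coordinates by `τ` and reflects
those marked by `r`. -/
def cubeSymm {n : ℕ} (τ : Equiv.Perm (Fin n)) (r : Fin n → Bool) (y : Fin n → ℝ) : Fin n → ℝ :=
  fun i => if r i then 1 - y (τ i) else y (τ i)

section CubeSymm

variable {n : ℕ}

lemma sum_abs_row_le_one {L : Matrix (Fin n) (Fin n) ℝ} {a : Fin n → ℝ}
    (h : ∀ y ∈ Set.Icc (0 : Fin n → ℝ) 1, L *ᵥ y + a ∈ Set.Icc (0 : Fin n → ℝ) 1) (i : Fin n) :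
    ∑ j, |L i j| ≤ 1 := by
  -- The vertices of the cube at which the `i`-th component is largest and smallest.
  have h1 := (h (fun j => if 0 ≤ L i j then 1 else 0)
    ⟨fun j => by simp only [Pi.zero_apply]; split_ifs <;> norm_num,
      fun j => by simp only [Pi.one_apply]; split_ifs <;> norm_num⟩).2 i
  have h2 := (h (fun j => if 0 ≤ L i j then 0 else 1)
    ⟨fun j => by simp only [Pi.zero_apply]; split_ifs <;> norm_num,
      fun j => by simp only [Pi.one_apply]; split_ifs <;> norm_num⟩).1 i
  simp only [Pi.add_apply, mulVec, dotProduct, Pi.one_apply, Pi.zero_apply] at h1 h2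
  have h3 : ∑ j, |L i j| = (∑ j, L i j * (if 0 ≤ L i j then 1 else 0))
      - ∑ j, L i j * (if 0 ≤ L i j then 0 else 1) := by
    rw [← Finset.sum_sub_distrib]
    refine Finset.sum_congr rfl fun j _ => ?_
    split_ifs with hj
    · simp [abs_of_nonneg hj]
    · simp [abs_of_neg (not_le.1 hj)]
  linarith

/-- An affine bijection of the unit cube onto itself is a signed permutation: the rows of both
matrices have `ℓ¹` norm at most `1`, so each row has a single nonzero entry `±1`. -/
lemma exists_eq_cubeSymm {L L' : Matrix (Fin n) (Fin n) ℝ} {a a' : Fin n → ℝ}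
    (h : ∀ y ∈ Set.Icc (0 : Fin n → ℝ) 1, L *ᵥ y + a ∈ Set.Icc (0 : Fin n → ℝ) 1)
    (h' : ∀ y ∈ Set.Icc (0 : Fin n → ℝ) 1, L' *ᵥ y + a' ∈ Set.Icc (0 : Fin n → ℝ) 1)
    (hL : L * L' = 1) :
    ∃ (τ : Equiv.Perm (Fin n)) (r : Fin n → Bool), ∀ y, L *ᵥ y + a = cubeSymm τ r y := by
  have hr := sum_abs_row_le_one h
  have hr' := sum_abs_row_le_one h'
  have hd : ∀ i, ∑ j, L i j * L' j i = 1 := fun i => by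
    have := congrFun (congrFun hL i) i
    simpa [Matrix.mul_apply] using this
  have hle : ∀ i j, |L' j i| ≤ 1 := fun i j =>
    (Finset.single_le_sum (f := fun l => |L' j l|) (fun _ _ => abs_nonneg _)
      (Finset.mem_univ i)).trans (hr' j)
  have hone : ∀ i j, L i j ≠ 0 → |L' j i| = 1 := by
    intro i j hij
    by_contra hne
    have hlt : |L' j i| < 1 := lt_of_le_of_ne (hle i j) hne
    have h1 : ∑ l, L i l * L' l i < ∑ l, |L i l| := by
      refine Finset.sum_lt_sum (fun l _ => ?_) ⟨j, Finset.mem_univ j, ?_⟩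
      · calc L i l * L' l i ≤ |L i l * L' l i| := le_abs_self _
          _ = |L i l| * |L' l i| := abs_mul _ _
          _ ≤ |L i l| * 1 := mul_le_mul_of_nonneg_left (hle i l) (abs_nonneg _)
          _ = |L i l| := mul_one _
      · calc L i j * L' j i ≤ |L i j * L' j i| := le_abs_self _
          _ = |L i j| * |L' j i| := abs_mul _ _
          _ < |L i j| * 1 := mul_lt_mul_of_pos_left hlt (abs_pos.2 hij)
          _ = |L i j| := mul_one _
    linarith [hd i, hr i]
  have huniq : ∀ i i' j, |L' j i| = 1 → |L' j i'| = 1 → i = i' := by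
    intro i i' j h1 h2
    by_contra hne
    have h3 : ∑ l ∈ {i, i'}, |L' j l| ≤ ∑ l, |L' j l| :=
      Finset.sum_le_sum_of_subset_of_nonneg (Finset.subset_univ _) fun _ _ _ => abs_nonneg _
    rw [Finset.sum_pair hne, h1, h2] at h3
    linarith [hr' j]
  have hex : ∀ i, ∃ j, L i j ≠ 0 := by
    intro i
    by_contra hcon
    push Not at hcon
    have := hd i
    simp [hcon] at this
  choose t ht using hex
  have htinj : Function.Injective t := fun i i' hii =>
    huniq i i' (t i) (hone _ _ (ht i)) (by rw [hii]; exact hone _ _ (ht i'))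
  have htbij := Finite.injective_iff_bijective.1 htinj
  have hzero : ∀ i j, j ≠ t i → L i j = 0 := by
    intro i j hj
    by_contra hne
    obtain ⟨i', rfl⟩ := htbij.2 j
    exact hj (congrArg t (huniq i i' (t i') (hone _ _ hne) (hone _ _ (ht i')))).symm
  have hrow : ∀ i (y : Fin n → ℝ), ∑ j, L i j * y j = L i (t i) * y (t i) := fun i y =>
    Finset.sum_eq_single (t i) (fun j _ hj => by rw [hzero i j hj, zero_mul]) (by simp)
  have hval : ∀ i, L i (t i) = 1 ∨ L i (t i) = -1 := by
    intro i
    have h1 := hrow i fun j => L' j i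
    rw [hd i] at h1
    rcases eq_or_eq_neg_of_abs_eq (hone i (t i) (ht i)) with h2 | h2 <;> rw [h2] at h1
    · left; linarith
    · right; linarith
  have hcase : ∀ i, (L i (t i) = 1 ∧ a i = 0) ∨ (L i (t i) = -1 ∧ a i = 1) := by
    intro i
    have h0 := h 0 ⟨le_rfl, zero_le_one⟩
    have h1 := h 1 ⟨zero_le_one, le_rfl⟩
    have h01 := h0.1 i
    have h02 := h0.2 i
    have h11 := h1.1 i
    have h12 := h1.2 i
    simp only [Pi.add_apply, mulVec, dotProduct, hrow, Pi.zero_apply, Pi.one_apply] at h01 h02 h11 h12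
    rcases hval i with h2 | h2 <;> rw [h2] at h01 h02 h11 h12
    · left; exact ⟨h2, by linarith⟩
    · right; exact ⟨h2, by linarith⟩
  refine ⟨Equiv.ofBijective t htbij, fun i => decide (L i (t i) = -1), fun y => ?_⟩
  ext i
  simp only [Pi.add_apply, mulVec, dotProduct, hrow, cubeSymm, decide_eq_true_eq,
    Equiv.ofBijective_apply]
  rcases hcase i with ⟨h2, h3⟩ | ⟨h2, h3⟩ <;> rw [h2, h3]
  · norm_num
  · norm_num; ring

/-- Two affinely parametrized parallelepipeds with the same point set differ by a symmetry of the
unit cube. Left inverses `G`, `G'` of the edge matrices express their nondegeneracy. -/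
lemma exists_cubeSymm_of_image_eq {m : ℕ} {C C' : Matrix (Fin m) (Fin n) ℝ}
    {G G' : Matrix (Fin n) (Fin m) ℝ} {c c' : Fin m → ℝ} (hG : G * C = 1) (hG' : G' * C' = 1)
    (h : (fun y => C *ᵥ y + c) '' Set.Icc 0 1 = (fun y => C' *ᵥ y + c') '' Set.Icc 0 1) :
    ∃ (τ : Equiv.Perm (Fin n)) (r : Fin n → Bool),
      ∀ y, C' *ᵥ y + c' = C *ᵥ cubeSymm τ r y + c := by
  -- The transition map from the second to the first parametrization, and its affine extension.
  have key : ∀ {C C' : Matrix (Fin m) (Fin n) ℝ} {G : Matrix (Fin n) (Fin m) ℝ}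
      {c c' : Fin m → ℝ}, G * C = 1 →
      (fun y => C *ᵥ y + c) '' Set.Icc 0 1 = (fun y => C' *ᵥ y + c') '' Set.Icc 0 1 →
      (∀ y ∈ Set.Icc (0 : Fin n → ℝ) 1,
        (G * C') *ᵥ y + G *ᵥ (c' - c) ∈ Set.Icc (0 : Fin n → ℝ) 1) ∧
      C *ᵥ (G *ᵥ (c' - c)) + c = c' ∧ C * (G * C') = C' := by
    intro C C' G c c' hG h
    have hy : ∀ y ∈ Set.Icc (0 : Fin n → ℝ) 1,
        (G * C') *ᵥ y + G *ᵥ (c' - c) ∈ Set.Icc (0 : Fin n → ℝ) 1 ∧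
        C *ᵥ ((G * C') *ᵥ y + G *ᵥ (c' - c)) + c = C' *ᵥ y + c' := by
      intro y hy
      have hm : C' *ᵥ y + c' ∈ (fun y => C *ᵥ y + c) '' Set.Icc 0 1 := h ▸ ⟨y, hy, rfl⟩
      obtain ⟨z, hz, hzy⟩ := hm
      have hz' : (G * C') *ᵥ y + G *ᵥ (c' - c) = z := by
        have : C' *ᵥ y + (c' - c) = C *ᵥ z := by
          simp only at hzy
          rw [← add_sub_assoc, ← hzy, add_sub_cancel_right]
        rw [← mulVec_mulVec, ← mulVec_add, this, mulVec_mulVec, hG, one_mulVec]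
      rw [hz']
      exact ⟨hz, hzy⟩
    have h0 : C *ᵥ (G *ᵥ (c' - c)) + c = c' := by
      simpa using (hy 0 ⟨le_rfl, zero_le_one⟩).2
    refine ⟨fun y hy' => (hy y hy').1, h0, ?_⟩
    refine Matrix.ext_of_mulVec_single fun j => ?_
    have h1 := (hy (Pi.single j 1) ⟨fun l => ?_, fun l => ?_⟩).2
    · have h2 : C *ᵥ ((G * C') *ᵥ Pi.single j 1) + (C *ᵥ (G *ᵥ (c' - c)) + c)
          = C' *ᵥ Pi.single j 1 + c' := by rw [← h1, mulVec_add, add_assoc]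
      rw [h0] at h2
      rw [← mulVec_mulVec]
      exact add_right_cancel h2
    all_goals
      rcases eq_or_ne l j with rfl | hl
      · simp
      · simp [hl]
  obtain ⟨hA, h0, hC⟩ := key hG h
  obtain ⟨hA', -, hC'⟩ := key hG' h.symm
  have hinv : (G * C') * (G' * C) = 1 := by rw [Matrix.mul_assoc, hC', hG]
  obtain ⟨τ, r, hτ⟩ := exists_eq_cubeSymm hA hA' hinv
  refine ⟨τ, r, fun y => ?_⟩
  rw [← hτ y, mulVec_add, mulVec_mulVec, hC, add_assoc, h0]

lemma continuous_cubeSymm (τ : Equiv.Perm (Fin n)) (r : Fin n → Bool) :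
    Continuous (cubeSymm τ r) := by
  refine continuous_pi fun i => ?_
  unfold cubeSymm
  split_ifs <;> fun_prop

lemma cubeSymm_injective (τ : Equiv.Perm (Fin n)) (r : Fin n → Bool) :
    Function.Injective (cubeSymm τ r) := by
  intro y z h
  ext j
  obtain ⟨i, rfl⟩ := τ.surjective j
  have := congrFun h i
  unfold cubeSymm at this
  split_ifs at this <;> linarith

lemma cubeSymm_preimage_Icc (τ : Equiv.Perm (Fin n)) (r : Fin n → Bool) :
    cubeSymm τ r ⁻¹' Set.Icc 0 1 = Set.Icc 0 1 := by
  have key : ∀ i (y : Fin n → ℝ), (0 ≤ cubeSymm τ r y i ∧ cubeSymm τ r y i ≤ 1) ↔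
      (0 ≤ y (τ i) ∧ y (τ i) ≤ 1) := by
    intro i y
    unfold cubeSymm
    split_ifs
    · constructor <;> rintro ⟨h1, h2⟩ <;> constructor <;> linarith
    · rfl
  ext y
  simp only [Set.mem_preimage, Set.mem_Icc, Pi.le_def, Pi.zero_apply, Pi.one_apply,
    ← forall_and, key]
  exact ⟨fun h j => by simpa using h (τ.symm j), fun h i => h (τ i)⟩

lemma measurePreserving_cubeSymm (τ : Equiv.Perm (Fin n)) (r : Fin n → Bool) :
    MeasurePreserving (cubeSymm τ r) volume volume := by
  have h1 := volume_measurePreserving_piCongrLeft (fun _ : Fin n => ℝ) τ.symm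
  have h2 : MeasurePreserving (fun (a : Fin n → ℝ) i =>
      (if r i then (fun x : ℝ => 1 - x) else id) (a i)) volume volume := by
    refine volume_preserving_pi fun i => ?_
    split_ifs
    · exact Measure.measurePreserving_sub_left volume 1
    · exact MeasurePreserving.id _
  convert h2.comp h1 using 1
  ext y i
  have : (MeasurableEquiv.piCongrLeft (fun _ : Fin n => ℝ) τ.symm) y i = y (τ i) := by
    have := Equiv.piCongrLeft_apply_apply (fun _ : Fin n => ℝ) τ.symm y (τ i)
    rwa [Equiv.symm_apply_apply] at this
  simp only [Function.comp_apply, this, cubeSymm]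
  split_ifs <;> rfl

lemma setIntegral_comp_cubeSymm (τ : Equiv.Perm (Fin n)) (r : Fin n → Bool)
    (F : (Fin n → ℝ) → ℝ) :
    ∫ y in Set.Icc 0 1, F (cubeSymm τ r y) = ∫ y in Set.Icc 0 1, F y := by
  have h := (measurePreserving_cubeSymm τ r).setIntegral_preimage_emb
    ((continuous_cubeSymm τ r).measurableEmbedding (cubeSymm_injective τ r)) F (Set.Icc 0 1)
  rwa [cubeSymm_preimage_Icc] at h

/-- Composition with a symmetry of the cube preserves the degree in each variable. -/
lemma exists_eval_cubeSymm {k : ℕ} (τ : Equiv.Perm (Fin n)) (r : Fin n → Bool)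
    {q : MvPolynomial (Fin n) ℝ} (hq : ∀ j, q.degreeOf j ≤ k) :
    ∃ q' : MvPolynomial (Fin n) ℝ, (∀ j, q'.degreeOf j ≤ k) ∧
      ∀ y, MvPolynomial.eval (cubeSymm τ r y) q = MvPolynomial.eval y q' := by
  classical
  let s : Fin n → MvPolynomial (Fin n) ℝ := fun i =>
    if r i then 1 - MvPolynomial.X (τ i) else MvPolynomial.X (τ i)
  have hs : ∀ i j, (s i).degreeOf j ≤ if j = τ i then 1 else 0 := by
    intro i j
    have hX : (MvPolynomial.X (τ i) : MvPolynomial (Fin n) ℝ).degreeOf j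
        = if j = τ i then 1 else 0 := by rw [MvPolynomial.degreeOf_X]
    simp only [s]
    split_ifs with h1 h2 h2
    · refine (MvPolynomial.degreeOf_sub_le _ _ _).trans ?_
      rw [hX]; simp [h2, MvPolynomial.degreeOf_one]
    · refine (MvPolynomial.degreeOf_sub_le _ _ _).trans ?_
      rw [hX]; simp [h2, MvPolynomial.degreeOf_one]
    · rw [hX]; simp [h2]
    · rw [hX]; simp [h2]
  refine ⟨MvPolynomial.bind₁ s q, fun j => ?_, fun y => ?_⟩
  · rw [MvPolynomial.bind₁, MvPolynomial.aeval_def, MvPolynomial.eval₂_eq']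
    refine (MvPolynomial.degreeOf_sum_le _ _ _).trans (Finset.sup_le fun α hα => ?_)
    refine (MvPolynomial.degreeOf_C_mul_le _ _ _).trans ?_
    refine (MvPolynomial.degreeOf_prod_le _ _ _).trans ?_
    calc ∑ i, (s i ^ α i).degreeOf j ≤ ∑ i, α i * (if j = τ i then 1 else 0) :=
          Finset.sum_le_sum fun i _ => (MvPolynomial.degreeOf_pow_le _ _ _).trans
            (Nat.mul_le_mul_left _ (hs i j))
      _ = α (τ.symm j) := by
          rw [Finset.sum_eq_single (τ.symm j)]
          · simp
          · intro i _ hi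
            rw [if_neg, mul_zero]
            rintro rfl
            simp at hi
          · simp
      _ ≤ k := (MvPolynomial.degreeOf_le_iff.1 (hq _)) α hα
  · change _ = MvPolynomial.eval₂Hom (RingHom.id ℝ) y (MvPolynomial.bind₁ s q)
    rw [MvPolynomial.eval₂Hom_bind₁, MvPolynomial.eval]
    congr 2
    ext i
    simp only [s, cubeSymm]
    split_ifs <;> simp

end CubeSymm

end RTProj

namespace RTProj

/-! ### Geometry of a cuboid -/

namespace Cuboid

variable {n : ℕ} (K : Cuboid n)

lemma col_ne_zero (i : Fin (n + 1)) : K.B.col i ≠ 0 := fun h =>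
  K.det_ne_zero (Matrix.det_eq_zero_of_column_eq_zero i fun j => congrFun h j)

lemma col_dotProduct_self_pos (i : Fin (n + 1)) : 0 < K.B.col i ⬝ᵥ K.B.col i := by
  have h : 0 ≤ K.B.col i ⬝ᵥ K.B.col i := Finset.sum_nonneg fun _ _ => mul_self_nonneg _
  exact lt_of_le_of_ne h fun h0 => K.col_ne_zero i (dotProduct_self_eq_zero.1 h0.symm)

lemma len_pos (i : Fin (n + 1)) : 0 < K.len i := Real.sqrt_pos.2 (K.col_dotProduct_self_pos i)

lemma len_sq (i : Fin (n + 1)) : K.len i ^ 2 = K.B.col i ⬝ᵥ K.B.col i :=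
  Real.sq_sqrt (K.col_dotProduct_self_pos i).le

lemma transpose_mul_self : K.Bᵀ * K.B = diagonal fun i => K.len i ^ 2 := by
  ext i j
  have : (K.Bᵀ * K.B) i j = K.B.col i ⬝ᵥ K.B.col j := rfl
  rw [this]
  rcases eq_or_ne i j with rfl | hij
  · rw [diagonal_apply_eq, len_sq]
  · rw [diagonal_apply_ne _ hij, K.orthogonal i j hij]

lemma abs_det : |K.B.det| = ∏ i, K.len i := by
  have h := congrArg det K.transpose_mul_self
  rw [det_mul, det_transpose, det_diagonal, Finset.prod_pow] at h
  rw [← abs_of_nonneg (Finset.prod_nonneg fun i _ => (K.len_pos i).le), ← sq_eq_sq_iff_abs_eq_abs,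
    ← h, sq]

lemma abs_det_eq_len_mul_facetArea (i : Fin (n + 1)) :
    |K.B.det| = K.len i * K.facetArea i := by
  rw [abs_det, Fin.prod_univ_succAbove _ i, facetArea]

lemma mul_diagonal_mul_transpose :
    K.B * ((diagonal fun i => (K.len i ^ 2)⁻¹) * K.Bᵀ) = 1 := by
  rw [mul_eq_one_comm, Matrix.mul_assoc, transpose_mul_self, diagonal_mul_diagonal,
    ← diagonal_one]
  congr 1
  ext i
  exact inv_mul_cancel₀ (pow_ne_zero 2 (K.len_pos i).ne')

/-- Expansion of a vector in the orthogonal basis of edges. -/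
lemma mulVec_edge_coords (x : Pt n) :
    K.B *ᵥ (fun i => (K.len i ^ 2)⁻¹ * (K.B.col i ⬝ᵥ x)) = x := by
  have h : (fun i => (K.len i ^ 2)⁻¹ * (K.B.col i ⬝ᵥ x))
      = ((diagonal fun i => (K.len i ^ 2)⁻¹) * K.Bᵀ) *ᵥ x := by
    ext i
    rw [← mulVec_mulVec, mulVec_diagonal]
    rfl
  rw [h, mulVec_mulVec, mul_diagonal_mul_transpose, one_mulVec]

lemma eq_smul_col {x : Pt n} {i : Fin (n + 1)}
    (h : ∀ j : Fin n, K.B.col (i.succAbove j) ⬝ᵥ x = 0) :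
    x = ((K.len i ^ 2)⁻¹ * (K.B.col i ⬝ᵥ x)) • K.B.col i := by
  conv_lhs => rw [← K.mulVec_edge_coords x]
  have h1 : (fun l => (K.len l ^ 2)⁻¹ * (K.B.col l ⬝ᵥ x))
      = Pi.single i ((K.len i ^ 2)⁻¹ * (K.B.col i ⬝ᵥ x)) := by
    ext l
    rcases eq_or_ne l i with rfl | hl
    · simp
    · obtain ⟨j, rfl⟩ := Fin.exists_succAbove_eq hl
      simp [h j]
  rw [h1, mulVec_single]
  ext l
  simp [mul_comm]

/-- The inverse of the affine map of the cuboid. -/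
noncomputable def invMap (x : Pt n) : Pt n := K.B⁻¹ *ᵥ (x - K.b)

lemma isUnit_det : IsUnit K.B.det := isUnit_iff_ne_zero.2 K.det_ne_zero

lemma map_invMap (x : Pt n) : K.map (K.invMap x) = x := by
  rw [map, invMap, mulVec_mulVec, mul_nonsing_inv _ K.isUnit_det, one_mulVec, sub_add_cancel]

lemma invMap_map (x : Pt n) : K.invMap (K.map x) = x := by
  rw [map, invMap, add_sub_cancel_right, mulVec_mulVec, nonsing_inv_mul _ K.isUnit_det,
    one_mulVec]

lemma map_injective : Function.Injective K.map := Function.LeftInverse.injective K.invMap_map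

lemma hasFDerivAt_mulVec_add {m : ℕ} (A : Matrix (Fin m) (Fin m) ℝ) (c x : Fin m → ℝ) :
    HasFDerivAt (fun y => A *ᵥ y + c) (LinearMap.toContinuousLinearMap (toLin' A)) x := by
  have h := (LinearMap.toContinuousLinearMap (toLin' A)).hasFDerivAt (x := x)
  exact h.add_const c

lemma hasFDerivAt_map (x : Pt n) :
    HasFDerivAt K.map (LinearMap.toContinuousLinearMap (toLin' K.B)) x :=
  hasFDerivAt_mulVec_add K.B K.b x

lemma contDiff_map {m : WithTop ℕ∞} : ContDiff ℝ m K.map :=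
  (LinearMap.toContinuousLinearMap (toLin' K.B)).contDiff.add contDiff_const

lemma continuous_map : Continuous K.map := (K.contDiff_map (m := 0)).continuous

lemma contDiff_invMap {m : WithTop ℕ∞} : ContDiff ℝ m K.invMap :=
  (LinearMap.toContinuousLinearMap (toLin' K.B⁻¹)).contDiff.comp (contDiff_id.sub contDiff_const)

lemma continuous_invMap : Continuous K.invMap := (K.contDiff_invMap (m := 0)).continuous

lemma isCompact_carrier : IsCompact K.carrier := isCompact_Icc.image K.continuous_map

lemma map_mem_interior_carrier {x : Pt n} (hx : ∀ i, 0 < x i ∧ x i < 1) :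
    K.map x ∈ interior K.carrier := by
  refine mem_interior.2 ⟨K.invMap ⁻¹' (Set.univ.pi fun _ => Set.Ioo (0 : ℝ) 1), ?_, ?_, ?_⟩
  · intro y hy
    exact ⟨K.invMap y, ⟨fun i => (hy i trivial).1.le, fun i => (hy i trivial).2.le⟩,
      K.map_invMap y⟩
  · exact (isOpen_set_pi Set.finite_univ fun _ _ => isOpen_Ioo).preimage K.continuous_invMap
  · simpa [invMap_map] using hx

/-! ### Facets -/

variable (i : Fin (n + 1)) (s : Bool)

lemma continuous_facetMap : Continuous (K.facetMap i s) := by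
  refine K.continuous_map.comp (continuous_pi fun j => ?_)
  rcases eq_or_ne j i with rfl | hj
  · simp only [Fin.insertNth_apply_same]
    exact continuous_const
  · obtain ⟨l, rfl⟩ := Fin.exists_succAbove_eq hj
    simp only [Fin.insertNth_apply_succAbove]
    exact continuous_apply l

/-- The edge matrix of a facet. -/
noncomputable def facetMatrix : Matrix (Fin (n + 1)) (Fin n) ℝ := K.B.submatrix id i.succAbove

lemma mulVec_insertNth (t : ℝ) (y : Fin n → ℝ) :
    K.B *ᵥ (i.insertNth t y : Pt n) = K.facetMatrix i *ᵥ y + t • K.B.col i := by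
  ext l
  simp only [mulVec, dotProduct, Pi.add_apply, Pi.smul_apply, smul_eq_mul, facetMatrix,
    submatrix_apply, id, Fin.sum_univ_succAbove _ i, Fin.insertNth_apply_same,
    Fin.insertNth_apply_succAbove, col_apply]
  ring

lemma facetMap_eq (y : Fin n → ℝ) : K.facetMap i s y =
    K.facetMatrix i *ᵥ y + ((if s then 1 else 0 : ℝ) • K.B.col i + K.b) := by
  rw [facetMap, map, mulVec_insertNth, add_assoc]

lemma facetMatrix_leftInverse :
    (K.B⁻¹.submatrix i.succAbove id) * K.facetMatrix i = 1 := by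
  rw [facetMatrix, ← Matrix.submatrix_mul _ _ _ _ _ Function.bijective_id,
    nonsing_inv_mul _ K.isUnit_det, Matrix.submatrix_one _ Fin.succAbove_right_injective]

lemma facetNormal_dotProduct_self : K.facetNormal i s ⬝ᵥ K.facetNormal i s = 1 := by
  have h := (K.len_pos i).ne'
  rw [facetNormal, smul_dotProduct, dotProduct_smul, ← len_sq, smul_eq_mul, smul_eq_mul]
  cases s <;> simp <;> field_simp

lemma col_dotProduct_facetNormal (j : Fin n) :
    K.B.col (i.succAbove j) ⬝ᵥ K.facetNormal i s = 0 := by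
  rw [facetNormal, dotProduct_smul, K.orthogonal _ _ (Fin.succAbove_ne i j), smul_zero]

/-- A facet of a cuboid determines its index and its side. -/
lemma facet_ext {i i' : Fin (n + 1)} {s s' : Bool}
    (h : K.facetMap i s '' Set.Icc 0 1 = K.facetMap i' s' '' Set.Icc 0 1) : i = i' ∧ s = s' := by
  have key : ∀ y ∈ Set.Icc (0 : Fin n → ℝ) 1, ∃ z ∈ Set.Icc (0 : Fin n → ℝ) 1,
      (i'.insertNth (if s' then 1 else 0 : ℝ) z : Pt n)
        = i.insertNth (if s then 1 else 0 : ℝ) y := by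
    intro y hy
    have : K.facetMap i s y ∈ K.facetMap i' s' '' Set.Icc 0 1 := h ▸ ⟨y, hy, rfl⟩
    obtain ⟨z, hz, hzy⟩ := this
    exact ⟨z, hz, K.map_injective hzy⟩
  have hval : ∀ y ∈ Set.Icc (0 : Fin n → ℝ) 1,
      (if s' then 1 else 0 : ℝ) = (i.insertNth (if s then 1 else 0 : ℝ) y : Pt n) i' := by
    intro y hy
    obtain ⟨z, -, hz⟩ := key y hy
    rw [← hz, Fin.insertNth_apply_same]
  have hi : i = i' := by
    by_contra hne
    obtain ⟨l, rfl⟩ := Fin.exists_succAbove_eq (Ne.symm hne)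
    have h0 := hval 0 ⟨le_rfl, zero_le_one⟩
    have h1 := hval 1 ⟨zero_le_one, le_rfl⟩
    rw [Fin.insertNth_apply_succAbove] at h0 h1
    rw [h0] at h1
    simp at h1
  subst hi
  refine ⟨rfl, ?_⟩
  have h0 := hval 0 ⟨le_rfl, zero_le_one⟩
  rw [Fin.insertNth_apply_same] at h0
  revert h0
  cases s <;> cases s' <;> simp

section Shared

variable {K} {K' : Cuboid n} {i i' : Fin (n + 1)} {s s' : Bool}

lemma exists_facetMap_eq
    (h : K.facetMap i s '' Set.Icc 0 1 = K'.facetMap i' s' '' Set.Icc 0 1) :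
    ∃ (τ : Equiv.Perm (Fin n)) (r : Fin n → Bool),
      ∀ y, K'.facetMap i' s' y = K.facetMap i s (cubeSymm τ r y) := by
  have h1 := funext (K.facetMap_eq i s)
  have h2 := funext (K'.facetMap_eq i' s')
  rw [h1, h2] at h
  obtain ⟨τ, r, hτ⟩ := exists_cubeSymm_of_image_eq (K.facetMatrix_leftInverse i)
    (K'.facetMatrix_leftInverse i') h
  exact ⟨τ, r, fun y => by rw [h1, h2]; exact hτ y⟩

/-- The edges of a shared facet agree up to order and sign. -/
lemma col_eq_of_facetMap_eq {τ : Equiv.Perm (Fin n)} {r : Fin n → Bool}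
    (h : ∀ y, K'.facetMap i' s' y = K.facetMap i s (cubeSymm τ r y)) (j : Fin n) :
    K'.B.col (i'.succAbove (τ j)) =
      (if r j then -1 else 1 : ℝ) • K.B.col (i.succAbove j) := by
  have h1 := h (Pi.single (τ j) 1)
  have h0 := h 0
  rw [facetMap_eq, facetMap_eq] at h1 h0
  have h2 : K'.facetMatrix i' *ᵥ Pi.single (τ j) 1 =
      K.facetMatrix i *ᵥ (cubeSymm τ r (Pi.single (τ j) 1) - cubeSymm τ r 0) := by
    rw [mulVec_zero, zero_add] at h0
    rw [mulVec_sub, eq_sub_iff_add_eq]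
    refine add_right_cancel (b := (if s then 1 else 0 : ℝ) • K.B.col i + K.b) ?_
    rw [← h1, h0, add_assoc]
  have h3 : cubeSymm τ r (Pi.single (τ j) 1) - cubeSymm τ r 0
      = Pi.single j (if r j then -1 else 1 : ℝ) := by
    ext l
    rcases eq_or_ne l j with rfl | hl
    · simp only [Pi.sub_apply, cubeSymm, Pi.single_eq_same, Pi.zero_apply]
      split_ifs <;> norm_num
    · have : τ l ≠ τ j := fun hh => hl (τ.injective hh)
      simp only [Pi.sub_apply, cubeSymm, Pi.single_eq_of_ne this, Pi.single_eq_of_ne hl,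
        Pi.zero_apply]
      split_ifs <;> norm_num
  rw [h3, mulVec_single, mulVec_single] at h2
  ext l
  have := congrFun h2 l
  simpa [facetMatrix, mul_comm] using this

lemma facetArea_eq (h : K.facetMap i s '' Set.Icc 0 1 = K'.facetMap i' s' '' Set.Icc 0 1) :
    K'.facetArea i' = K.facetArea i := by
  obtain ⟨τ, r, hτ⟩ := exists_facetMap_eq h
  rw [facetArea, facetArea, ← Equiv.prod_comp τ]
  refine Finset.prod_congr rfl fun j _ => ?_
  rw [len, len, col_eq_of_facetMap_eq hτ j, smul_dotProduct, dotProduct_smul]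
  split_ifs <;> simp

lemma facetIntegral_eq (h : K.facetMap i s '' Set.Icc 0 1 = K'.facetMap i' s' '' Set.Icc 0 1)
    (F : Pt n → ℝ) : K'.facetIntegral i' s' F = K.facetIntegral i s F := by
  obtain ⟨τ, r, hτ⟩ := exists_facetMap_eq h
  rw [facetIntegral, facetIntegral, facetArea_eq h]
  simp only [hτ]
  rw [setIntegral_comp_cubeSymm τ r fun y => F (K.facetMap i s y)]

lemma IsFacetQ.of_shared {k : ℕ} {q : Pt n → ℝ} (hq : K.IsFacetQ k i s q)
    (h : K.facetMap i s '' Set.Icc 0 1 = K'.facetMap i' s' '' Set.Icc 0 1) :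
    K'.IsFacetQ k i' s' q := by
  obtain ⟨τ, r, hτ⟩ := exists_facetMap_eq h
  obtain ⟨P, hP, hqP⟩ := hq
  obtain ⟨P', hP', hPP'⟩ := exists_eval_cubeSymm τ r (k := k) (q := P)
    fun j => MvPolynomial.degreeOf_le_iff.2 fun α hα => hP α hα j
  exact ⟨P', fun α hα j => MvPolynomial.degreeOf_le_iff.1 (hP' j) α hα,
    fun y => by rw [hτ, hqP, hPP']⟩

/-- Moving from the midpoint of a facet against the outer normal leads into the cuboid. -/
lemma facetMap_sub_smul_normal_mem (K : Cuboid n) (i : Fin (n + 1)) (s : Bool) {t : ℝ}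
    (ht : 0 < t) (ht' : t < K.len i) :
    K.facetMap i s (fun _ => 1 / 2) - t • K.facetNormal i s ∈ interior K.carrier := by
  have h : K.facetMap i s (fun _ => 1 / 2) - t • K.facetNormal i s =
      K.map (i.insertNth (if s then 1 - t / K.len i else t / K.len i) fun _ => 1 / 2) := by
    rw [facetMap_eq, map, mulVec_insertNth, facetNormal]
    ext l
    cases s <;> simp <;> ring
  have h1 : 0 < t / K.len i := div_pos ht (K.len_pos i)
  have h2 : t / K.len i < 1 := (div_lt_one (K.len_pos i)).2 ht'
  rw [h]
  refine K.map_mem_interior_carrier fun j => ?_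
  rcases eq_or_ne j i with rfl | hj
  · rw [Fin.insertNth_apply_same]
    cases s <;> simp [h1, h2]
  · obtain ⟨l, rfl⟩ := Fin.exists_succAbove_eq hj
    rw [Fin.insertNth_apply_succAbove]
    norm_num

/-- Two cuboids which share a facet but do not overlap have opposite outer normals there. -/
lemma facetNormal_eq_neg (h : K.facetMap i s '' Set.Icc 0 1 = K'.facetMap i' s' '' Set.Icc 0 1)
    (hd : Disjoint (interior K.carrier) (interior K'.carrier)) :
    K'.facetNormal i' s' = -K.facetNormal i s := by
  obtain ⟨τ, r, hτ⟩ := exists_facetMap_eq h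
  -- Both normals are orthogonal to the common edges, hence parallel.
  have hperp : ∀ j, K.B.col (i.succAbove j) ⬝ᵥ K'.facetNormal i' s' = 0 := by
    intro j
    have h1 := K'.col_dotProduct_facetNormal i' s' (τ j)
    rw [col_eq_of_facetMap_eq hτ j, smul_dotProduct] at h1
    split_ifs at h1 <;> simpa using h1
  have h1 := K.eq_smul_col hperp
  have h2 := K.eq_smul_col (K.col_dotProduct_facetNormal i s)
  set x := K'.facetNormal i' s' with hx
  set z := K.facetNormal i s with hz
  set lam := (K.len i ^ 2)⁻¹ * (K.B.col i ⬝ᵥ x)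
  set mu := (K.len i ^ 2)⁻¹ * (K.B.col i ⬝ᵥ z)
  have hxx : x ⬝ᵥ x = 1 := K'.facetNormal_dotProduct_self i' s'
  have hzz : z ⬝ᵥ z = 1 := K.facetNormal_dotProduct_self i s
  have hsq : lam ^ 2 = mu ^ 2 := by
    have hc := K.col_dotProduct_self_pos i
    rw [h1, smul_dotProduct, dotProduct_smul, smul_eq_mul, smul_eq_mul] at hxx
    rw [h2, smul_dotProduct, dotProduct_smul, smul_eq_mul, smul_eq_mul] at hzz
    have : lam ^ 2 * (K.B.col i ⬝ᵥ K.B.col i) = mu ^ 2 * (K.B.col i ⬝ᵥ K.B.col i) := by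
      linarith
    exact mul_right_cancel₀ hc.ne' this
  rcases sq_eq_sq_iff_eq_or_eq_neg.1 hsq with h3 | h3
  · exfalso
    have hxz : x = z := by rw [h1, h2, h3]
    -- Equal normals would place the two cuboids on the same side of the facet.
    obtain ⟨t, ht, htl⟩ := exists_between (lt_min (K.len_pos i) (K'.len_pos i'))
    have hm1 := K.facetMap_sub_smul_normal_mem i s ht (htl.trans_le (min_le_left _ _))
    have hm2 := K'.facetMap_sub_smul_normal_mem i' s' ht (htl.trans_le (min_le_right _ _))
    have hmid : cubeSymm τ r (fun _ => 1 / 2) = fun _ => 1 / 2 := by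
      ext l
      simp only [cubeSymm]
      split_ifs <;> norm_num
    rw [hτ, hmid, ← hx, hxz] at hm2
    exact Set.disjoint_left.1 hd hm1 hm2
  · rw [h1, h2, h3, neg_smul]

end Shared

end Cuboid

end RTProj

namespace RTProj

/-! ### Polynomials as smooth functions -/

section Polynomial

variable {m : ℕ}

lemma contDiff_eval (q : MvPolynomial (Fin m) ℝ) {k : WithTop ℕ∞} :
    ContDiff ℝ k fun x : Fin m → ℝ => MvPolynomial.eval x q := by
  induction q using MvPolynomial.induction_on with
  | C a => simpa using contDiff_const
  | add p q hp hq => simpa using hp.add hq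
  | mul_X p i hp => simpa using hp.mul (contDiff_apply ℝ ℝ i)

lemma fderiv_eval_single (q : MvPolynomial (Fin m) ℝ) (x : Fin m → ℝ) (i : Fin m) :
    fderiv ℝ (fun x : Fin m → ℝ => MvPolynomial.eval x q) x (Pi.single i 1)
      = MvPolynomial.eval x (MvPolynomial.pderiv i q) := by
  have hd : ∀ p : MvPolynomial (Fin m) ℝ,
      DifferentiableAt ℝ (fun x : Fin m → ℝ => MvPolynomial.eval x p) x := fun p =>
    ((contDiff_eval p (k := 1)).differentiable one_ne_zero) x
  induction q using MvPolynomial.induction_on with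
  | C a => simp
  | add p q hp hq =>
    simp only [map_add]
    rw [fderiv_fun_add (hd p) (hd q), _root_.add_apply, hp, hq]
  | mul_X p j hp =>
    have hj : HasFDerivAt (fun x : Fin m → ℝ => x j) (ContinuousLinearMap.proj j) x :=
      (ContinuousLinearMap.proj (R := ℝ) (φ := fun _ : Fin m => ℝ) j).hasFDerivAt
    simp only [map_mul, MvPolynomial.eval_X, MvPolynomial.pderiv_mul, map_add]
    rw [fderiv_fun_mul (hd p) hj.differentiableAt, hj.fderiv]
    simp only [_root_.add_apply, _root_.smul_apply, hp,
      ContinuousLinearMap.proj_apply, smul_eq_mul, MvPolynomial.pderiv_X, Pi.single_apply]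
    rcases eq_or_ne i j with rfl | hij
    · simp; ring
    · simp [hij.symm]; ring

lemma degreeOf_pderiv_bound {k : ℕ} {q : MvPolynomial (Fin m) ℝ}
    (hq : ∀ α ∈ q.support, ∀ j, α j ≤ k) (i : Fin m) :
    ∀ α ∈ (MvPolynomial.pderiv i q).support, ∀ j, (α j + if i = j then 1 else 0) ≤ k := by
  intro α hα j
  rw [MvPolynomial.mem_support_iff, MvPolynomial.coeff_pderiv] at hα
  have h := hq _ (MvPolynomial.mem_support_iff.2 (left_ne_zero_of_mul hα)) j
  rwa [Finsupp.add_apply, Finsupp.single_apply] at h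

end Polynomial

section Calculus

variable {n : ℕ}

lemma contDiff_grad {f : Pt n → ℝ} (hf : ContDiff ℝ 2 f) : ContDiff ℝ 1 (grad f) :=
  contDiff_pi.2 fun _ => (hf.fderiv_right (m := 1) (by norm_num)).clm_apply contDiff_const

lemma continuous_grad {f : Pt n → ℝ} (hf : ContDiff ℝ 1 f) : Continuous (grad f) :=
  continuous_pi fun _ => (hf.continuous_fderiv one_ne_zero).clm_apply continuous_const

lemma continuous_divergence {u : Pt n → Pt n} (hu : ContDiff ℝ 1 u) :
    Continuous (divergence u) :=
  continuous_finsetSum _ fun i _ =>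
    (continuous_apply i).comp ((hu.continuous_fderiv one_ne_zero).clm_apply continuous_const)

lemma divergence_smul {u : Pt n → Pt n} {q : Pt n → ℝ} (hu : ContDiff ℝ 1 u)
    (hq : ContDiff ℝ 1 q) (x : Pt n) :
    divergence (fun y => q y • u y) x = divergence u x * q x + u x ⬝ᵥ grad q x := by
  have h1 := (hu.differentiable one_ne_zero) x
  have h2 := (hq.differentiable one_ne_zero) x
  simp only [divergence, grad, dotProduct]
  rw [fderiv_fun_smul h2 h1, Finset.sum_mul, ← Finset.sum_add_distrib]
  refine Finset.sum_congr rfl fun i _ => ?_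
  simp
  ring

lemma fderiv_apply_eq_dotProduct_grad (f : Pt n → ℝ) (x v : Pt n) :
    fderiv ℝ f x v = v ⬝ᵥ grad f x := by
  have : v = ∑ i, v i • (Pi.single i 1 : Pt n) := by
    ext j
    simp [Finset.sum_apply, Pi.single_apply]
  conv_lhs => rw [this]
  simp [dotProduct, grad]

end Calculus

/-! ### Integration by parts on a cuboid -/

namespace Cuboid

variable {n : ℕ} (K : Cuboid n)

lemma setIntegral_carrier (F : Pt n → ℝ) :
    ∫ x in K.carrier, F x = |K.B.det| * ∫ x in Set.Icc 0 1, F (K.map x) := by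
  rw [carrier, integral_image_eq_integral_abs_det_fderiv_smul volume measurableSet_Icc
    (fun x _ => (K.hasFDerivAt_map x).hasFDerivWithinAt) K.map_injective.injOn]
  simp only [LinearMap.det_toContinuousLinearMap, LinearMap.det_toLin', smul_eq_mul]
  rw [integral_const_mul]

/-- The trace of a linear map in the orthogonal basis of edges. -/
lemma sum_edge_derivative (T : Pt n →L[ℝ] Pt n) :
    ∑ i, (K.len i ^ 2)⁻¹ * (K.B.col i ⬝ᵥ T (K.B.col i)) = ∑ i, T (Pi.single i 1) i := by
  let A := LinearMap.toMatrix' (T : Pt n →ₗ[ℝ] Pt n)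
  have hA : ∀ v, T v = A *ᵥ v := fun v => by
    rw [← toLin'_apply, toLin'_toMatrix']; rfl
  have h1 : ∑ i, T (Pi.single i 1) i = A.trace := by
    simp [hA, Matrix.trace]
  have h2 : ∑ i, (K.len i ^ 2)⁻¹ * (K.B.col i ⬝ᵥ T (K.B.col i))
      = (((diagonal fun i => (K.len i ^ 2)⁻¹) * K.Bᵀ) * (A * K.B)).trace := by
    rw [Matrix.trace, Matrix.mul_assoc]
    refine Finset.sum_congr rfl fun i _ => ?_
    rw [diag_apply, diagonal_mul, hA]
    rfl
  rw [h1, h2, trace_mul_comm, Matrix.mul_assoc, mul_diagonal_mul_transpose, Matrix.mul_one]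

/-- The divergence theorem on a cuboid. -/
lemma setIntegral_divergence {F : Pt n → Pt n} (hF : ContDiff ℝ 1 F) :
    ∫ x in K.carrier, divergence F x =
      ∑ i, ∑ s, K.facetIntegral i s fun x => F x ⬝ᵥ K.facetNormal i s := by
  -- In reference coordinates the field becomes `G`, with `div G = (div F) ∘ μ`.
  let A : Pt n →L[ℝ] Pt n := LinearMap.toContinuousLinearMap
    (toLin' ((diagonal fun i => (K.len i ^ 2)⁻¹) * K.Bᵀ))
  have hA : ∀ v i, A v i = (K.len i ^ 2)⁻¹ * (K.B.col i ⬝ᵥ v) := by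
    intro v i
    change (((diagonal fun i => (K.len i ^ 2)⁻¹) * K.Bᵀ) *ᵥ v) i = _
    rw [← mulVec_mulVec, mulVec_diagonal]
    rfl
  let G : Pt n → Pt n := fun x => A (F (K.map x))
  let G' : Pt n → Pt n →L[ℝ] Pt n := fun x =>
    A.comp ((fderiv ℝ F (K.map x)).comp (LinearMap.toContinuousLinearMap (toLin' K.B)))
  have hG : ∀ x, HasFDerivAt G (G' x) x := fun x =>
    A.hasFDerivAt.comp x
      (((hF.differentiable one_ne_zero) (K.map x)).hasFDerivAt.comp x (K.hasFDerivAt_map x))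
  have hdiv : ∀ x, ∑ i, G' x (Pi.single i 1) i = divergence F (K.map x) := by
    intro x
    refine Eq.trans ?_ (K.sum_edge_derivative (fderiv ℝ F (K.map x)))
    refine Finset.sum_congr rfl fun i _ => ?_
    simp only [G', ContinuousLinearMap.comp_apply, hA]
    simp
  have key := integral_divergence_of_hasFDerivAt_off_countable (0 : Pt n) 1 zero_le_one G G' ∅
    Set.countable_empty (fun x _ => (hG x).continuousAt.continuousWithinAt) (fun x _ => hG x)
    (by
      simp only [hdiv]
      exact ((continuous_divergence hF).comp K.continuous_map).continuousOn.integrableOn_compact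
        isCompact_Icc)
  simp only [hdiv] at key
  rw [setIntegral_carrier, key, Finset.mul_sum]
  refine Finset.sum_congr rfl fun i _ => ?_
  have hl := (K.len_pos i).ne'
  have hside : ∀ s : Bool, K.facetIntegral i s (fun x => F x ⬝ᵥ K.facetNormal i s)
      = (if s then 1 else -1 : ℝ) * (|K.B.det| *
        ∫ y in Set.Icc (0 : Fin n → ℝ) 1, G (i.insertNth (if s then 1 else 0 : ℝ) y) i) := by
    intro s
    rw [facetIntegral, K.abs_det_eq_len_mul_facetArea i]
    simp only [G, hA]
    rw [integral_const_mul]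
    have : ∀ y, F (K.facetMap i s y) ⬝ᵥ K.facetNormal i s = ((if s then 1 else -1 : ℝ) / K.len i) *
        (K.B.col i ⬝ᵥ F (K.map (i.insertNth (if s then 1 else 0 : ℝ) y))) := by
      intro y
      rw [facetNormal, dotProduct_smul, smul_eq_mul, facetMap, dotProduct_comm]
    simp only [this]
    rw [integral_const_mul]
    field_simp
  rw [Fintype.sum_bool, hside, hside]
  simp only [if_true, Bool.false_eq_true, if_false]
  simp only [Function.comp_def, Pi.zero_apply, Pi.one_apply]
  change |K.B.det| * ((∫ y in Set.Icc (0 : Fin n → ℝ) 1, G (i.insertNth (1 : ℝ) y) i) -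
    ∫ y in Set.Icc (0 : Fin n → ℝ) 1, G (i.insertNth (0 : ℝ) y) i) = _
  ring

lemma integrableOn_carrier {F : Pt n → ℝ} (hF : Continuous F) :
    IntegrableOn F K.carrier :=
  hF.continuousOn.integrableOn_compact K.isCompact_carrier

lemma setIntegral_divergence_mul {u : Pt n → Pt n} {q : Pt n → ℝ} (hu : ContDiff ℝ 1 u)
    (hq : ContDiff ℝ 1 q) :
    ∫ x in K.carrier, divergence u x * q x = -(∫ x in K.carrier, u x ⬝ᵥ grad q x) +
      ∑ i, ∑ s, K.facetIntegral i s fun x => (u x ⬝ᵥ K.facetNormal i s) * q x := by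
  have h := K.setIntegral_divergence (hq.smul hu)
  have h1 : ∀ x, divergence (fun y => q y • u y) x = _ := divergence_smul hu hq
  have h2 : ∫ x in K.carrier, divergence (q • u) x =
      (∫ x in K.carrier, divergence u x * q x) + ∫ x in K.carrier, u x ⬝ᵥ grad q x := by
    rw [← integral_add]
    · exact integral_congr_ae (Filter.Eventually.of_forall h1)
    · exact K.integrableOn_carrier ((continuous_divergence hu).mul hq.continuous)
    · exact K.integrableOn_carrier (hu.continuous.dotProduct (continuous_grad hq))
  have h3 : ∀ i s, K.facetIntegral i s (fun x => (q • u) x ⬝ᵥ K.facetNormal i s)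
      = K.facetIntegral i s fun x => (u x ⬝ᵥ K.facetNormal i s) * q x := by
    intro i s
    congr 1
    ext x
    simp [mul_comm]
  simp only [← h3]
  linarith

/-! ### Polynomial spaces on a cuboid -/

variable {K}

lemma IsQ.contDiff {k : ℕ} {f : Pt n → ℝ} (hf : K.IsQ k f) {m : WithTop ℕ∞} :
    ContDiff ℝ m f := by
  obtain ⟨q, -, hq⟩ := hf
  have : f = (fun x => MvPolynomial.eval x q) ∘ K.invMap := by
    ext x
    rw [Function.comp_apply, ← hq, map_invMap]
  rw [this]
  exact (contDiff_eval q).comp K.contDiff_invMap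

lemma IsQ.isFacetQ {k : ℕ} {f : Pt n → ℝ} (hf : K.IsQ k f) (i : Fin (n + 1)) (s : Bool) :
    K.IsFacetQ k i s f := by
  classical
  obtain ⟨q, hq, hfq⟩ := hf
  let c : Fin (n + 1) → MvPolynomial (Fin n) ℝ :=
    i.insertNth (MvPolynomial.C (if s then 1 else 0 : ℝ)) MvPolynomial.X
  have hcs : c i = MvPolynomial.C (if s then 1 else 0 : ℝ) := Fin.insertNth_apply_same ..
  have hcj : ∀ j, c (i.succAbove j) = MvPolynomial.X j := fun j =>
    Fin.insertNth_apply_succAbove ..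
  refine ⟨MvPolynomial.bind₁ c q, ?_, fun y => ?_⟩
  · intro α hα j
    refine MvPolynomial.degreeOf_le_iff.1 ?_ α hα
    rw [MvPolynomial.bind₁, MvPolynomial.aeval_def, MvPolynomial.eval₂_eq']
    refine (MvPolynomial.degreeOf_sum_le _ _ _).trans (Finset.sup_le fun β hβ => ?_)
    refine (MvPolynomial.degreeOf_C_mul_le _ _ _).trans ?_
    refine (MvPolynomial.degreeOf_prod_le _ _ _).trans ?_
    rw [Fin.sum_univ_succAbove _ i, hcs, ← MvPolynomial.C_pow, MvPolynomial.degreeOf_C, zero_add]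
    simp only [hcj]
    calc ∑ l, (MvPolynomial.X l ^ β (i.succAbove l) : MvPolynomial (Fin n) ℝ).degreeOf j
        ≤ ∑ l, β (i.succAbove l) * (if j = l then 1 else 0) :=
          Finset.sum_le_sum fun l _ => (MvPolynomial.degreeOf_pow_le _ _ _).trans
            (Nat.mul_le_mul_left _ (by rw [MvPolynomial.degreeOf_X]))
      _ = β (i.succAbove j) := by simp
      _ ≤ k := hq β hβ _
  · rw [facetMap, hfq]
    change _ = MvPolynomial.eval₂Hom (RingHom.id ℝ) y (MvPolynomial.bind₁ c q)
    rw [MvPolynomial.eval₂Hom_bind₁, MvPolynomial.eval]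
    congr 2
    ext l
    rcases eq_or_ne l i with rfl | hl
    · simp [hcs]
    · obtain ⟨j, rfl⟩ := Fin.exists_succAbove_eq hl
      simp [hcj]

lemma IsFacetQ.sub {k : ℕ} {f g : Pt n → ℝ} {i : Fin (n + 1)} {s : Bool}
    (hf : K.IsFacetQ k i s f) (hg : K.IsFacetQ k i s g) :
    K.IsFacetQ k i s fun x => f x - g x := by
  classical
  obtain ⟨P, hP, hfP⟩ := hf
  obtain ⟨Q, hQ, hgQ⟩ := hg
  refine ⟨P - Q, fun α hα j => ?_, fun y => by simp only [hfP, hgQ, map_sub]⟩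
  rcases Finset.mem_union.1 (MvPolynomial.support_sub _ P Q hα) with h | h
  · exact hP α h j
  · exact hQ α h j

/-- The gradient of a function in `Q^k` is an admissible interior test field: as the edges are
orthogonal, `∇q = B D⁻² ∇̂q̂`, where `D` is the diagonal matrix of edge lengths. -/
lemma IsQ.isPsi_grad {k : ℕ} {f : Pt n → ℝ} (hf : K.IsQ k f) : K.IsPsi k (grad f) := by
  have hsm : ContDiff ℝ 1 f := hf.contDiff
  obtain ⟨q, hq, hfq⟩ := hf
  have hdet : |K.B.det| ≠ 0 := abs_ne_zero.2 K.det_ne_zero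
  refine ⟨fun i => MvPolynomial.C (|K.B.det| * (K.len i ^ 2)⁻¹) * MvPolynomial.pderiv i q,
    fun i α hα j => ?_, fun x => ?_⟩
  · refine degreeOf_pderiv_bound hq i α ?_ j
    rw [MvPolynomial.mem_support_iff, MvPolynomial.coeff_C_mul] at hα
    exact MvPolynomial.mem_support_iff.2 (right_ne_zero_of_mul hα)
  · -- The chain rule in the direction of the `i`-th edge.
    have hchain : ∀ i, MvPolynomial.eval x (MvPolynomial.pderiv i q)
        = K.B.col i ⬝ᵥ grad f (K.map x) := by
      intro i
      rw [← fderiv_eval_single, ← fderiv_apply_eq_dotProduct_grad]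
      have h1 : (fun x => MvPolynomial.eval x q) = f ∘ K.map := by
        ext y
        exact (hfq y).symm
      rw [h1, fderiv_comp x ((hsm.differentiable one_ne_zero) _)
        (K.hasFDerivAt_map x).differentiableAt, (K.hasFDerivAt_map x).fderiv]
      simp
    conv_lhs => rw [← K.mulVec_edge_coords (grad f (K.map x))]
    rw [piola, ← mulVec_smul]
    congr 1
    ext i
    simp only [Pi.smul_apply, smul_eq_mul, map_mul, MvPolynomial.eval_C, hchain]
    field_simp

lemma IsPsi.eq_zero {ρ : Pt n → Pt n} (h : K.IsPsi 0 ρ) : ρ = 0 := by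
  obtain ⟨u, hu, hρ⟩ := h
  have hu0 : ∀ i, u i = 0 := by
    intro i
    rw [← MvPolynomial.support_eq_empty, Finset.eq_empty_iff_forall_notMem]
    intro α hα
    have := hu i α hα i
    simp at this
  ext x l
  rw [← K.map_invMap x, hρ, piola]
  simp only [hu0, map_zero]
  have : (fun _ : Fin (n + 1) => (0 : ℝ)) = 0 := rfl
  rw [this, mulVec_zero, smul_zero]
  rfl

/-- The components of a Raviart-Thomas field of degree `k` lie in `Q^(k+1)`. -/
lemma IsRT.isQ_apply {k : ℕ} {v : Pt n → Pt n} (hv : K.IsRT k v) (l : Fin (n + 1)) :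
    K.IsQ (k + 1) fun x => v x l := by
  obtain ⟨u, hu, hvu⟩ := hv
  refine ⟨∑ i, MvPolynomial.C (1 / |K.B.det| * K.B l i) * u i, fun α hα j => ?_, fun x => ?_⟩
  · refine MvPolynomial.degreeOf_le_iff.1 ?_ α hα
    refine (MvPolynomial.degreeOf_sum_le _ _ _).trans (Finset.sup_le fun i _ => ?_)
    refine (MvPolynomial.degreeOf_C_mul_le _ _ _).trans (MvPolynomial.degreeOf_le_iff.2 ?_)
    intro β hβ
    have := hu i β hβ j
    split_ifs at this <;> omega
  · simp only [hvu, piola, Pi.smul_apply, smul_eq_mul, mulVec, dotProduct, map_sum, map_mul,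
      MvPolynomial.eval_C, Finset.mul_sum, mul_assoc]

lemma IsQ.add_smul {k : ℕ} {f g : Pt n → ℝ} (hf : K.IsQ k f) (hg : K.IsQ k g) (c : ℝ) :
    K.IsQ k fun x => f x + c * g x := by
  classical
  obtain ⟨P, hP, hfP⟩ := hf
  obtain ⟨Q, hQ, hgQ⟩ := hg
  refine ⟨P + MvPolynomial.C c * Q, fun α hα j => ?_, fun y => by simp [hfP, hgQ]⟩
  rcases Finset.mem_union.1 (MvPolynomial.support_add hα) with h | h
  · exact hP α h j
  · rw [MvPolynomial.mem_support_iff, MvPolynomial.coeff_C_mul] at h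
    exact hQ α (MvPolynomial.mem_support_iff.2 (right_ne_zero_of_mul h)) j

lemma IsQ.eq_zero_of_eqOn {k : ℕ} {f : Pt n → ℝ} (hf : K.IsQ k f)
    (h : ∀ x ∈ K.carrier, f x = 0) : f = 0 := by
  obtain ⟨q, -, hq⟩ := hf
  have hq0 : q = 0 := by
    refine MvPolynomial.funext_set (fun _ => Set.Icc (0 : ℝ) 1)
      (fun _ => Set.Icc_infinite zero_lt_one) fun x hx => ?_
    rw [← hq, map_zero]
    exact h _ ⟨x, ⟨fun i => (hx i trivial).1, fun i => (hx i trivial).2⟩, rfl⟩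
  ext x
  rw [← K.map_invMap x, hq, hq0, map_zero]
  rfl

variable (K)

/-- A continuous field on a cuboid with vanishing `L²` norm is zero. -/
lemma eq_zero_of_setIntegral_dotProduct_self {u : Pt n → Pt n} (hu : Continuous u)
    (h : ∫ x in K.carrier, u x ⬝ᵥ u x = 0) : ∀ x ∈ K.carrier, u x = 0 := by
  have hnn : ∀ x, 0 ≤ u x ⬝ᵥ u x := fun x => Finset.sum_nonneg fun _ _ => mul_self_nonneg _
  have hc : Continuous fun x => u (K.map x) ⬝ᵥ u (K.map x) :=
    (hu.comp K.continuous_map).dotProduct (hu.comp K.continuous_map)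
  rw [setIntegral_carrier K fun x => u x ⬝ᵥ u x] at h
  have h1 := (mul_eq_zero.1 h).resolve_left (abs_ne_zero.2 K.det_ne_zero)
  rw [integral_eq_zero_iff_of_nonneg (fun x => hnn _)
    (hc.continuousOn.integrableOn_compact isCompact_Icc)] at h1
  have hsub : Set.Icc (0 : Pt n) 1 ⊆ closure (interior (Set.Icc (0 : Pt n) 1)) := by
    rw [(convex_Icc (𝕜 := ℝ) (0 : Pt n) 1).closure_interior_eq_closure_of_nonempty_interior]
    · exact subset_closure
    · refine ⟨fun _ => 1 / 2, ?_⟩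
      rw [← Set.pi_univ_Icc, interior_pi_set Set.finite_univ]
      intro i _
      norm_num [interior_Icc]
  have h2 := Measure.eqOn_of_ae_eq (μ := volume) h1 hc.continuousOn continuousOn_const hsub
  rintro _ ⟨x, hx, rfl⟩
  exact dotProduct_self_eq_zero.1 (h2 hx)

end Cuboid

end RTProj

namespace RTProj

/-! ### Faces of the mesh -/

namespace CuboidMesh

variable {n N : ℕ} (M : CuboidMesh n N)

lemma normal_eq_neg {f f' : Facet n N} (hne : f.1 ≠ f'.1)
    (h : facetSet M.cell f = facetSet M.cell f') : M.normal f' = -M.normal f :=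
  Cuboid.facetNormal_eq_neg h (M.disjoint _ _ hne)

lemma faceInt_eq_of_shared {f f' : Facet n N} (h : facetSet M.cell f = facetSet M.cell f')
    (F : Pt n → ℝ) : M.faceInt f' F = M.faceInt f F :=
  Cuboid.facetIntegral_eq h F

/-- At most two facets have the same point set: three cells around one facet would have pairwise
opposite unit normals. -/
lemma facet_eq_of_shared {f f₁ f₂ : Facet n N} (h₁ : f.1 ≠ f₁.1) (h₂ : f.1 ≠ f₂.1)
    (hs₁ : facetSet M.cell f = facetSet M.cell f₁)
    (hs₂ : facetSet M.cell f = facetSet M.cell f₂) : f₁ = f₂ := by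
  have hs := hs₁.symm.trans hs₂
  have hc : f₁.1 = f₂.1 := by
    by_contra hne
    have h3 := M.normal_eq_neg hne hs
    rw [M.normal_eq_neg h₁ hs₁, M.normal_eq_neg h₂ hs₂, neg_neg] at h3
    have h4 : M.normal f ⬝ᵥ M.normal f = 1 := (M.cell f.1).facetNormal_dotProduct_self _ _
    have h5 : M.normal f = 0 := by
      ext i
      have := congrFun h3 i
      simp only [Pi.neg_apply] at this
      simp only [Pi.zero_apply]
      linarith
    rw [h5, zero_dotProduct] at h4
    exact zero_ne_one h4
  obtain ⟨E₁, i₁, s₁⟩ := f₁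
  obtain ⟨E₂, i₂, s₂⟩ := f₂
  simp only at hc
  subst hc
  obtain ⟨rfl, rfl⟩ := (M.cell E₁).facet_ext hs
  rfl

lemma mem_bdryFaces {f : Facet n N} : f ∈ M.bdryFaces ↔
    ∀ f' : Facet n N, f'.1 ≠ f.1 → facetSet M.cell f' ≠ facetSet M.cell f := by
  simp [bdryFaces]

/-- Every facet of a cell is a boundary face or one of the two sides of a unique interior face. -/
lemma sum_facets (G : Facet n N → ℝ) :
    ∑ f, G f = ∑ e ∈ M.intFaces, (G e.1 + G e.2) + ∑ f ∈ M.bdryFaces, G f := by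
  classical
  have hinj₁ : Set.InjOn (Prod.fst : Facet n N × Facet n N → Facet n N) M.intFaces := by
    rintro ⟨f, f₁⟩ h₁ ⟨f', f₂⟩ h₂ (rfl : f = f')
    have a₁ := M.intFaces_shared _ h₁
    have a₂ := M.intFaces_shared _ h₂
    exact congrArg (f, ·) (M.facet_eq_of_shared a₁.1 a₂.1 a₁.2 a₂.2)
  have hinj₂ : Set.InjOn (Prod.snd : Facet n N × Facet n N → Facet n N) M.intFaces := by
    rintro ⟨f₁, f⟩ h₁ ⟨f₂, f'⟩ h₂ (rfl : f = f')
    have a₁ := M.intFaces_shared _ h₁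
    have a₂ := M.intFaces_shared _ h₂
    exact congrArg (·, f) (M.facet_eq_of_shared a₁.1.symm a₂.1.symm a₁.2.symm a₂.2.symm)
  have hdisj : Disjoint (M.intFaces.image Prod.fst) (M.intFaces.image Prod.snd) := by
    rw [Finset.disjoint_left]
    intro f hf₁ hf₂
    obtain ⟨⟨f', f₁⟩, h₁, rfl⟩ := Finset.mem_image.1 hf₁
    obtain ⟨⟨f₂, f''⟩, h₂, h⟩ := Finset.mem_image.1 hf₂
    simp only at h
    subst h
    have a₁ := M.intFaces_shared _ h₁
    have a₂ := M.intFaces_shared _ h₂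
    -- The same face would occur in both orientations.
    have heq := M.facet_eq_of_shared a₁.1 a₂.1.symm a₁.2 a₂.2.symm
    subst heq
    rcases M.oriented _ _ a₁.1 a₁.2 with h | h
    · exact h.2 h₂
    · exact h.2 h₁
  have hcompl : M.intFaces.image Prod.fst ∪ M.intFaces.image Prod.snd
      = Finset.univ \ M.bdryFaces := by
    ext f
    simp only [Finset.mem_union, Finset.mem_image, Finset.mem_sdiff, Finset.mem_univ, true_and,
      mem_bdryFaces]
    constructor
    · rintro (⟨e, he, rfl⟩ | ⟨e, he, rfl⟩) hb
      · exact hb e.2 (M.intFaces_shared e he).1.symm (M.intFaces_shared e he).2.symm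
      · exact hb e.1 (M.intFaces_shared e he).1 (M.intFaces_shared e he).2
    · intro hb
      push Not at hb
      obtain ⟨f', hne, hs⟩ := hb
      rcases M.oriented f f' hne.symm hs.symm with h | h
      · exact Or.inl ⟨_, h.1, rfl⟩
      · exact Or.inr ⟨_, h.1, rfl⟩
  rw [← Finset.sum_sdiff (Finset.subset_univ M.bdryFaces), ← hcompl, Finset.sum_union hdisj,
    Finset.sum_image hinj₁, Finset.sum_image hinj₂, Finset.sum_add_distrib]

lemma sum_bdryFaces {ΓD : Finset (Facet n N)} (hΓD : ΓD ⊆ M.bdryFaces) (G : Facet n N → ℝ) :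
    ∑ f ∈ M.bdryFaces, G f = ∑ f ∈ M.neumann ΓD, G f + ∑ f ∈ ΓD, G f :=
  (Finset.sum_sdiff hΓD).symm

/-- Summing over the cells and then over the interior faces of each cell counts each interior face
from both sides. -/
lemma sum_cells_intFaces (G : Fin N → Facet n N × Facet n N → ℝ) :
    ∑ E, ∑ e ∈ M.intFaces with e.1.1 = E ∨ e.2.1 = E, G E e
      = ∑ e ∈ M.intFaces, (G e.1.1 e + G e.2.1 e) := by
  simp only [Finset.sum_filter]
  rw [Finset.sum_comm]
  refine Finset.sum_congr rfl fun e he => ?_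
  have hne := (M.intFaces_shared e he).1
  have h : ∀ E, (if e.1.1 = E ∨ e.2.1 = E then G E e else 0)
      = (if e.1.1 = E then G E e else 0) + if e.2.1 = E then G E e else 0 := by
    intro E
    by_cases h1 : e.1.1 = E
    · have h2 : e.2.1 ≠ E := fun h2 => hne (h1.trans h2.symm)
      simp [h1, h2]
    · simp [h1]
  simp only [h, Finset.sum_add_distrib, Finset.sum_ite_eq, Finset.mem_univ, if_true]

lemma sum_cells_faces (S : Finset (Facet n N)) (G : Fin N → Facet n N → ℝ) :
    ∑ E, ∑ f ∈ S with f.1 = E, G E f = ∑ f ∈ S, G f.1 f := by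
  simp only [Finset.sum_filter]
  rw [Finset.sum_comm]
  simp

/-! ### Linearity of the integrals -/

lemma faceInt_const_mul (f : Facet n N) (c : ℝ) (F : Pt n → ℝ) :
    M.faceInt f (fun x => c * F x) = c * M.faceInt f F := by
  simp only [faceInt, Cuboid.facetIntegral]
  rw [integral_const_mul]
  ring

lemma faceInt_neg (f : Facet n N) (F : Pt n → ℝ) :
    M.faceInt f (fun x => -F x) = -M.faceInt f F := by
  simpa using M.faceInt_const_mul f (-1) F

lemma faceInt_add (f : Facet n N) {F G : Pt n → ℝ} (hF : Continuous F) (hG : Continuous G) :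
    M.faceInt f (fun x => F x + G x) = M.faceInt f F + M.faceInt f G := by
  have hc := (M.cell f.1).continuous_facetMap f.2.1 f.2.2
  simp only [faceInt, Cuboid.facetIntegral]
  have hi : ∀ {H : Pt n → ℝ}, Continuous H → IntegrableOn
      (fun y => H ((M.cell f.1).facetMap f.2.1 f.2.2 y)) (Set.Icc (0 : Fin n → ℝ) 1) :=
    fun hH => (hH.comp hc).continuousOn.integrableOn_compact isCompact_Icc
  rw [integral_add (hi hF) (hi hG), mul_add]

lemma cellInt_add (E : Fin N) {F G : Pt n → ℝ} (hF : Continuous F) (hG : Continuous G) :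
    M.cellInt E (fun x => F x + G x) = M.cellInt E F + M.cellInt E G :=
  integral_add ((M.cell E).integrableOn_carrier hF) ((M.cell E).integrableOn_carrier hG)

lemma cellInt_sub (E : Fin N) {F G : Pt n → ℝ} (hF : Continuous F) (hG : Continuous G) :
    M.cellInt E (fun x => F x - G x) = M.cellInt E F - M.cellInt E G :=
  integral_sub ((M.cell E).integrableOn_carrier hF) ((M.cell E).integrableOn_carrier hG)

lemma continuous_dotProduct_mul {u : Pt n → Pt n} {q : Pt n → ℝ} (hu : Continuous u)
    (hq : Continuous q) (ν : Pt n) : Continuous fun x => (u x ⬝ᵥ ν) * q x :=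
  (hu.dotProduct continuous_const).mul hq

lemma continuous_jump {q : Broken n N} (hq : ∀ E, Continuous (q E))
    (e : Facet n N × Facet n N) : Continuous (jump e q) :=
  (hq _).sub (hq _)

lemma continuous_avg {q : Broken n N} (hq : ∀ E, Continuous (q E))
    (e : Facet n N × Facet n N) : Continuous (avg e q) :=
  (continuous_const.mul (hq _)).add (continuous_const.mul (hq _))

lemma continuous_jumpVec {u : BrokenVec n N} (hu : ∀ E, Continuous (u E))
    (e : Facet n N × Facet n N) : Continuous (jumpVec e u) :=
  (hu _).sub (hu _)

lemma continuous_avgVec {u : BrokenVec n N} (hu : ∀ E, Continuous (u E))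
    (e : Facet n N × Facet n N) : Continuous (avgVec e u) :=
  ((hu _).const_smul (1 / 2 : ℝ)).add ((hu _).const_smul (1 / 2 : ℝ))

/-! ### The discrete divergence form -/

section Forms

variable {ΓD : Finset (Facet n N)} {u : BrokenVec n N} {q : Broken n N}

/-- Cellwise integration by parts turns `b` into its dual form, in which the test function carries
the derivative and the jumps. -/
lemma b_eq (hΓD : ΓD ⊆ M.bdryFaces) (hu : ∀ E, ContDiff ℝ 1 (u E))
    (hq : ∀ E, ContDiff ℝ 1 (q E)) :
    M.b ΓD u q = (∑ E, M.cellInt E fun x => u E x ⬝ᵥ grad (q E) x)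
      - (∑ e ∈ M.intFaces,
          M.faceInt e.1 fun x => (avgVec e u x ⬝ᵥ M.normal e.1) * jump e q x)
      - ∑ f ∈ M.neumann ΓD, M.faceInt f fun x => (u f.1 x ⬝ᵥ M.normal f) * q f.1 x := by
  have huc : ∀ E, Continuous (u E) := fun E => (hu E).continuous
  have hqc : ∀ E, Continuous (q E) := fun E => (hq E).continuous
  let G : Facet n N → ℝ := fun f => M.faceInt f fun x => (u f.1 x ⬝ᵥ M.normal f) * q f.1 x
  have hcell : ∑ E, M.cellInt E (fun x => divergence (u E) x * q E x) =
      -(∑ E, M.cellInt E fun x => u E x ⬝ᵥ grad (q E) x) + ∑ f, G f := by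
    rw [Fintype.sum_prod_type, ← Finset.sum_neg_distrib, ← Finset.sum_add_distrib]
    refine Finset.sum_congr rfl fun E _ => ?_
    rw [Fintype.sum_prod_type]
    exact (M.cell E).setIntegral_divergence_mul (hu E) (hq E)
  -- The product rule for jumps, `[u q] = [u]{q} + {u}[q]`.
  have hface : ∀ e ∈ M.intFaces, G e.1 + G e.2 =
      (M.faceInt e.1 fun x => (jumpVec e u x ⬝ᵥ M.normal e.1) * avg e q x)
        + M.faceInt e.1 fun x => (avgVec e u x ⬝ᵥ M.normal e.1) * jump e q x := by
    intro e he
    obtain ⟨hne, hs⟩ := M.intFaces_shared e he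
    have h2 : G e.2 = M.faceInt e.1 fun x => -((u e.2.1 x ⬝ᵥ M.normal e.1) * q e.2.1 x) := by
      simp only [G]
      rw [M.faceInt_eq_of_shared hs, M.normal_eq_neg hne hs]
      simp only [dotProduct_neg, neg_mul]
    have h3 := continuous_dotProduct_mul (huc e.1.1) (hqc e.1.1) (M.normal e.1)
    have h4 := continuous_dotProduct_mul (huc e.2.1) (hqc e.2.1) (M.normal e.1)
    have h5 := M.faceInt_add e.1 h3 h4.neg
    simp only [Pi.neg_apply] at h5
    rw [h2]
    refine h5.symm.trans ?_
    rw [← M.faceInt_add e.1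
      (continuous_dotProduct_mul (continuous_jumpVec huc e) (continuous_avg hqc e) _)
      (continuous_dotProduct_mul (continuous_avgVec huc e) (continuous_jump hqc e) _)]
    congr 1
    ext x
    simp only [jumpVec, avgVec, avg, jump, sub_dotProduct, add_dotProduct, smul_dotProduct,
      smul_eq_mul]
    ring
  rw [b, hcell, M.sum_facets, M.sum_bdryFaces hΓD, Finset.sum_congr rfl hface,
    Finset.sum_add_distrib]
  ring

lemma b_add (hΓD : ΓD ⊆ M.bdryFaces) {u' : BrokenVec n N} (hu : ∀ E, ContDiff ℝ 1 (u E))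
    (hu' : ∀ E, ContDiff ℝ 1 (u' E)) (hq : ∀ E, ContDiff ℝ 1 (q E)) :
    M.b ΓD (u + u') q = M.b ΓD u q + M.b ΓD u' q := by
  have huc : ∀ E, Continuous (u E) := fun E => (hu E).continuous
  have huc' : ∀ E, Continuous (u' E) := fun E => (hu' E).continuous
  have hqc : ∀ E, Continuous (q E) := fun E => (hq E).continuous
  have hcell : ∀ E, M.cellInt E (fun x => (u + u') E x ⬝ᵥ grad (q E) x) =
      (M.cellInt E fun x => u E x ⬝ᵥ grad (q E) x)
        + M.cellInt E fun x => u' E x ⬝ᵥ grad (q E) x := by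
    intro E
    rw [← M.cellInt_add E ((huc E).dotProduct (continuous_grad (hq E)))
      ((huc' E).dotProduct (continuous_grad (hq E)))]
    simp only [Pi.add_apply, add_dotProduct]
  have hint : ∀ e, M.faceInt e.1 (fun x => (avgVec e (u + u') x ⬝ᵥ M.normal e.1) * jump e q x)
      = (M.faceInt e.1 fun x => (avgVec e u x ⬝ᵥ M.normal e.1) * jump e q x)
        + M.faceInt e.1 fun x => (avgVec e u' x ⬝ᵥ M.normal e.1) * jump e q x := by
    intro e
    rw [← M.faceInt_add e.1
      (continuous_dotProduct_mul (continuous_avgVec huc e) (continuous_jump hqc e) _)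
      (continuous_dotProduct_mul (continuous_avgVec huc' e) (continuous_jump hqc e) _)]
    congr 1
    ext x
    simp only [avgVec, Pi.add_apply, smul_add, add_dotProduct]
    ring
  have hneu : ∀ f : Facet n N,
      M.faceInt f (fun x => ((u + u') f.1 x ⬝ᵥ M.normal f) * q f.1 x)
      = (M.faceInt f fun x => (u f.1 x ⬝ᵥ M.normal f) * q f.1 x)
        + M.faceInt f fun x => (u' f.1 x ⬝ᵥ M.normal f) * q f.1 x := by
    intro f
    rw [← M.faceInt_add f (continuous_dotProduct_mul (huc _) (hqc _) _)
      (continuous_dotProduct_mul (huc' _) (hqc _) _)]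
    simp only [Pi.add_apply, add_dotProduct, add_mul]
  rw [M.b_eq hΓD hu hq, M.b_eq hΓD hu' hq,
    M.b_eq hΓD (u := u + u') (fun E => (hu E).add (hu' E)) hq]
  simp only [hcell, hint, hneu, Finset.sum_add_distrib]
  ring

end Forms

/-! ### The reconstruction satisfies `b(γ, q) = -α(ψ, q)` -/

section Reconstruction

variable {ΓD : Finset (Facet n N)} {σ : ℝ} {k p : ℕ} {ψ q : Broken n N} {γ v w : BrokenVec n N}

/-- A broken field with components in `Q^p` is smooth on each cell. -/
lemma contDiff_of_mem_spaceX (hv : v ∈ M.spaceX p) (E : Fin N) {m : WithTop ℕ∞} :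
    ContDiff ℝ m (v E) :=
  contDiff_pi.2 fun i => (hv i E).contDiff

lemma mem_spaceX_of_mem_spaceRT (hγ : γ ∈ M.spaceRT k) : γ ∈ M.spaceX (k + 1) :=
  fun i E => (hγ.2 E).isQ_apply i

/-- The cell moments determine `(γ, ∇q)`, since `∇q` is an interior test field; for `k = 0`, where
no cell moments are prescribed, the gradient vanishes. -/
lemma cellInt_reconstruction_grad (hγ : M.IsReconstruction ΓD σ k ψ γ) (hq : q ∈ M.spaceQ k)
    (E : Fin N) :
    M.cellInt E (fun x => γ E x ⬝ᵥ grad (q E) x) =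
      -M.cellInt E (fun x => grad (ψ E) x ⬝ᵥ grad (q E) x)
        + (1 / 2) * (∑ e ∈ M.intFaces with e.1.1 = E ∨ e.2.1 = E,
            M.faceInt e.1 fun x => (grad (q E) x ⬝ᵥ M.normal e.1) * jump e ψ x)
        + ∑ f ∈ M.neumann ΓD with f.1 = E,
            M.faceInt f fun x => (grad (q E) x ⬝ᵥ M.normal f) * ψ f.1 x := by
  have hpsi := (hq E).isPsi_grad
  rcases Nat.eq_zero_or_pos k with rfl | hk
  · rw [hpsi.eq_zero]
    simp [cellInt, faceInt, Cuboid.facetIntegral]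
  · exact hγ.moment_cell hk E _ hpsi

/-- The face moments determine the face terms, since the jump `[q]` is a polynomial on the face
from either side. -/
lemma faceInt_reconstruction_jump (hγ : M.IsReconstruction ΓD σ k ψ γ)
    (hψ : ψ ∈ M.spaceQ k) (hq : q ∈ M.spaceQ k) {e : Facet n N × Facet n N}
    (he : e ∈ M.intFaces) :
    M.faceInt e.1 (fun x => (avgVec e γ x ⬝ᵥ M.normal e.1) * jump e q x) =
      -(M.faceInt e.1 fun x => (avgVec e (brokenGrad ψ) x ⬝ᵥ M.normal e.1) * jump e q x)
        + σ / M.hInt e * M.faceInt e.1 fun x => jump e q x * jump e ψ x := by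
  have hjump : (M.cell e.1.1).IsFacetQ k e.1.2.1 e.1.2.2 (jump e q) :=
    ((hq _).isFacetQ _ _).sub
      (Cuboid.IsFacetQ.of_shared ((hq e.2.1).isFacetQ _ _) (M.intFaces_shared e he).2.symm)
  have hqc : ∀ E, Continuous (q E) := fun E => ((hq E).contDiff (m := 0)).continuous
  have hψc : ∀ E, Continuous (ψ E) := fun E => ((hψ E).contDiff (m := 0)).continuous
  have hψg : ∀ E, Continuous (grad (ψ E)) := fun E => continuous_grad (hψ E).contDiff
  have hγc : ∀ E, Continuous (γ E) := fun E =>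
    (M.contDiff_of_mem_spaceX (M.mem_spaceX_of_mem_spaceRT hγ.mem_RT) E (m := 0)).continuous
  have hjc : Continuous (jump e q) := continuous_jump hqc e
  have hc : ∀ E, Continuous fun x => 1 / 2 * ((γ E x ⬝ᵥ M.normal e.1) * jump e q x) := fun E =>
    continuous_const.mul (continuous_dotProduct_mul (hγc E) hjc _)
  have hsplit : M.faceInt e.1 (fun x => (avgVec e γ x ⬝ᵥ M.normal e.1) * jump e q x) =
      1 / 2 * M.faceInt e.1 (fun x => (γ e.1.1 x ⬝ᵥ M.normal e.1) * jump e q x)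
      + 1 / 2 * M.faceInt e.1 (fun x => (γ e.2.1 x ⬝ᵥ M.normal e.1) * jump e q x) := by
    rw [← M.faceInt_const_mul, ← M.faceInt_const_mul,
      ← M.faceInt_add _ (hc _) (hc _)]
    congr 1
    ext x
    simp only [avgVec, add_dotProduct, smul_dotProduct, smul_eq_mul]
    ring
  rw [hsplit, hγ.moment_int e he _ (Or.inl rfl) _ hjump, hγ.moment_int e he _ (Or.inr rfl) _ hjump,
    ← add_mul, add_halves, one_mul, ← M.faceInt_neg, ← M.faceInt_const_mul, ← M.faceInt_add]
  · congr 1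
    ext x
    ring
  · exact (continuous_dotProduct_mul (continuous_avgVec (u := brokenGrad ψ) hψg e) hjc _).neg
  · exact continuous_const.mul (hjc.mul (continuous_jump hψc e))

lemma faceInt_reconstruction_neumann (hγ : M.IsReconstruction ΓD σ k ψ γ)
    (hψ : ψ ∈ M.spaceQ k) (hq : q ∈ M.spaceQ k) {f : Facet n N} (hf : f ∈ M.neumann ΓD) :
    M.faceInt f (fun x => (γ f.1 x ⬝ᵥ M.normal f) * q f.1 x) =
      -(M.faceInt f fun x => (grad (ψ f.1) x ⬝ᵥ M.normal f) * q f.1 x)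
        + σ / M.hBdry f * M.faceInt f fun x => q f.1 x * ψ f.1 x := by
  have hqc : Continuous (q f.1) := ((hq f.1).contDiff (m := 0)).continuous
  have hψc : Continuous (ψ f.1) := ((hψ f.1).contDiff (m := 0)).continuous
  have hψg : Continuous (grad (ψ f.1)) := continuous_grad (hψ f.1).contDiff
  rw [hγ.moment_neumann f hf _ ((hq f.1).isFacetQ _ _), ← M.faceInt_neg, ← M.faceInt_const_mul,
    ← M.faceInt_add]
  · congr 1
    ext x
    ring
  · exact (continuous_dotProduct_mul hψg hqc _).neg
  · exact continuous_const.mul (hqc.mul hψc)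

theorem b_reconstruction (hΓD : ΓD ⊆ M.bdryFaces) (hγ : M.IsReconstruction ΓD σ k ψ γ)
    (hψ : ψ ∈ M.spaceQ k) (hq : q ∈ M.spaceQ k) : M.b ΓD γ q = -M.sipg ΓD σ ψ q := by
  have hq1 : ∀ E, ContDiff ℝ 1 (q E) := fun E => (hq E).contDiff
  have hqg : ∀ E, Continuous (grad (q E)) := fun E => continuous_grad (hq1 E)
  have hψc : ∀ E, Continuous (ψ E) := fun E => ((hψ E).contDiff (m := 0)).continuous
  have hγ1 : ∀ E, ContDiff ℝ 1 (γ E) := fun E =>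
    M.contDiff_of_mem_spaceX (M.mem_spaceX_of_mem_spaceRT hγ.mem_RT) E
  have hψ1 : ∀ E, ContDiff ℝ 1 (brokenGrad ψ E) := fun E => contDiff_grad (hψ E).contDiff
  -- The lifting terms of the cell moments add up to the averages `({∇q} · n_e, [ψ])`.
  have havg : ∀ e, 1 / 2 *
      ((M.faceInt e.1 fun x => (grad (q e.1.1) x ⬝ᵥ M.normal e.1) * jump e ψ x)
        + M.faceInt e.1 fun x => (grad (q e.2.1) x ⬝ᵥ M.normal e.1) * jump e ψ x)
      = M.faceInt e.1 fun x => (avgVec e (brokenGrad q) x ⬝ᵥ M.normal e.1) * jump e ψ x := by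
    intro e
    have hc : ∀ E, Continuous fun x => (grad (q E) x ⬝ᵥ M.normal e.1) * jump e ψ x := fun E =>
      continuous_dotProduct_mul (hqg E) (continuous_jump hψc e) _
    rw [← M.faceInt_add _ (hc _) (hc _), ← M.faceInt_const_mul]
    congr 1
    ext x
    simp only [avgVec, brokenGrad, add_dotProduct, smul_dotProduct, smul_eq_mul]
    ring
  have hcells : ∑ E, M.cellInt E (fun x => γ E x ⬝ᵥ grad (q E) x) =
      -(∑ E, M.cellInt E fun x => brokenGrad ψ E x ⬝ᵥ grad (q E) x)
        + (∑ e ∈ M.intFaces, M.faceInt e.1 fun x =>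
            (avgVec e (brokenGrad q) x ⬝ᵥ M.normal e.1) * jump e ψ x)
        + ∑ f ∈ M.neumann ΓD, M.faceInt f fun x =>
            (grad (q f.1) x ⬝ᵥ M.normal f) * ψ f.1 x := by
    rw [Finset.sum_congr rfl fun E _ => M.cellInt_reconstruction_grad hγ hq E,
      Finset.sum_add_distrib, Finset.sum_add_distrib, Finset.sum_neg_distrib, ← Finset.mul_sum,
      M.sum_cells_intFaces fun E e =>
        M.faceInt e.1 fun x => (grad (q E) x ⬝ᵥ M.normal e.1) * jump e ψ x,
      sum_cells_faces (M.neumann ΓD) fun E f =>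
        M.faceInt f fun x => (grad (q E) x ⬝ᵥ M.normal f) * ψ f.1 x,
      Finset.mul_sum, Finset.sum_congr rfl fun e _ => havg e]
    rfl
  rw [sipg, j0, M.b_eq hΓD hγ1 hq1, M.b_eq hΓD hψ1 hq1, hcells,
    Finset.sum_congr rfl fun e he => M.faceInt_reconstruction_jump hγ hψ hq he,
    Finset.sum_congr rfl fun f hf => M.faceInt_reconstruction_neumann hγ hψ hq hf]
  simp only [Finset.sum_add_distrib, Finset.sum_neg_distrib, brokenGrad]
  ring

/-- As `RT_h^(p-1)` lies in `X_h^p`, the `L²` projection in the last step is an exact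
update. -/
lemma eq_add_of_l2Vec (hv : v ∈ M.spaceX p) (hw : w ∈ M.spaceX p) (hγ : γ ∈ M.spaceX p)
    (h : ∀ φ ∈ M.spaceX p, M.l2Vec v φ = M.l2Vec w φ + M.l2Vec γ φ) : v = w + γ := by
  have hvc : ∀ E, Continuous (v E) := fun E => (M.contDiff_of_mem_spaceX hv E (m := 0)).continuous
  have hwc : ∀ E, Continuous (w E) := fun E => (M.contDiff_of_mem_spaceX hw E (m := 0)).continuous
  have hγc : ∀ E, Continuous (γ E) := fun E => (M.contDiff_of_mem_spaceX hγ E (m := 0)).continuous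
  let φ : BrokenVec n N := fun E x => v E x - w E x - γ E x
  have hφc : ∀ E, Continuous (φ E) := fun E => ((hvc E).sub (hwc E)).sub (hγc E)
  have hφ : φ ∈ M.spaceX p := fun i E => by
    have := ((hv i E).add_smul (hw i E) (-1)).add_smul (hγ i E) (-1)
    convert this using 2
    simp only [φ, Pi.sub_apply]
    ring
  have hsum : ∑ E, M.cellInt E (fun x => φ E x ⬝ᵥ φ E x) = 0 := by
    have h1 : ∀ E, M.cellInt E (fun x => φ E x ⬝ᵥ φ E x) =
        M.cellInt E (fun x => v E x ⬝ᵥ φ E x) - M.cellInt E (fun x => w E x ⬝ᵥ φ E x)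
          - M.cellInt E (fun x => γ E x ⬝ᵥ φ E x) := by
      intro E
      have hv' := (hvc E).dotProduct (hφc E)
      have hw' := (hwc E).dotProduct (hφc E)
      have h3 : Continuous fun x => v E x ⬝ᵥ φ E x - w E x ⬝ᵥ φ E x := hv'.sub hw'
      rw [← M.cellInt_sub E hv' hw', ← M.cellInt_sub E h3 ((hγc E).dotProduct (hφc E))]
      simp only [← sub_dotProduct]
      rfl
    have h2 := h φ hφ
    simp only [l2Vec] at h2
    simp only [h1, Finset.sum_sub_distrib, h2]
    ring
  have hnn : ∀ E ∈ Finset.univ, 0 ≤ M.cellInt E (fun x => φ E x ⬝ᵥ φ E x) := fun E _ =>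
    integral_nonneg fun x => Finset.sum_nonneg fun _ _ => mul_self_nonneg _
  have hzero := (Finset.sum_eq_zero_iff_of_nonneg hnn).1 hsum
  ext E x i
  have h1 := (M.cell E).eq_zero_of_setIntegral_dotProduct_self (hφc E)
    (hzero E (Finset.mem_univ E))
  have h2 := congrFun ((hφ i E).eq_zero_of_eqOn fun x hx => congrFun (h1 x hx) i) x
  simp only [φ, Pi.sub_apply, Pi.zero_apply] at h2
  simp only [Pi.add_apply]
  linarith

end Reconstruction

end CuboidMesh

end RTProj

theorem theorem2 {n N p : ℕ} (hn : n = 1 ∨ n = 2) (hp : 1 ≤ p)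
    (M : RTProj.CuboidMesh n N)
    (ΓD : Finset (RTProj.Facet n N)) (hΓD : ΓD ⊆ M.bdryFaces)
    (σ : ℝ) (g : RTProj.Pt n → RTProj.Pt n)
    (hg : ∀ f ∈ ΓD, IntegrableOn (fun y => g ((M.cell f.1).facetMap f.2.1 f.2.2 y))
      (Set.Icc (0 : Fin n → ℝ) 1))
    (hcompat : M.neumann ΓD = ∅ → ∑ f ∈ ΓD, M.faceInt f (fun x => g x ⬝ᵥ M.normal f) = 0)
    (w : RTProj.BrokenVec n N) (hw : w ∈ M.spaceX p)
    (v : RTProj.BrokenVec n N) (hv : M.IsRTProjection ΓD σ g p w v) :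
    ∀ q ∈ M.spaceM ΓD (p - 1), M.b ΓD v q = M.r ΓD g q := by
  intro q hq
  obtain ⟨ψ, γ, ⟨hψ, hsolve⟩, hγ, hvX, hproj⟩ := hv
  have hγX : γ ∈ M.spaceX p := by
    have := M.mem_spaceX_of_mem_spaceRT hγ.mem_RT
    rwa [Nat.sub_add_cancel hp] at this
  rw [M.eq_add_of_l2Vec hvX hw hγX hproj,
    M.b_add hΓD (fun E => M.contDiff_of_mem_spaceX hw E) (fun E => M.contDiff_of_mem_spaceX hγX E)
      (fun E => (hq.1 E).contDiff),
    M.b_reconstruction hΓD hγ hψ.1 hq.1, hsolve q hq]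
  ring
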